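/- **QBFs.** Literals are variables $z$ and negated variables $\overline z$; clauses are finite sets of literals, and a clause is tautological if it contains some $z$ and $\overline z$. A QBF $\Phi=Q\cdot\phi$ has a prefix $Q=Q_1Z_1\cdots Q_kZ_k$ of alternating quantifiers $\exists,\forall$ over disjoint finite blocks of Boolean variables, and a matrix $\phi$, a finite set of clauses over these variables. "$z$ is left of $z'$" means that the block of $z$ comes strictly before that of $z'$. From $C\ni z$ and $D\ni\overline z$, resolution over the pivot $z$ gives $\mathrm{res}(C,D,z)=(C\setminus\{z\})\cup(D\setminus\{\overline z\})$. A derivation is a finite sequence of lines, each obtained by a rule from earlier lines. **MRes.** A *merge map* is a finite set of instructions with distinct line numbers in $\mathbb N$, each of the form "output $b$" with $b\in\{*,0,1\}$ or "if $x=0$ go to line $\ell_1$ else go to line $\ell_2$" with smaller $\ell_1,\ell_2$; the instruction with the largest number is the leading one. It is *trivial* if it is the single instruction "output $*$". Two merge maps are *consistent* if instructions with equal line number are equal, and *isomorphic* ($\simeq$) if a bijective renumbering of lines transforms one into the other. A line is a pair $(C,\{M^u\}_{u})$ of a clause $C$ of existential literals and a merge map $M^u$ for each universal variable $u$. * *Axiom:*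 for a non-tautological $A\in\phi$ and any $i\in\mathbb N$, derive $C=$ the existential part of $A$, with $M^u=\langle i\rangle: b_u$, where $b_u$ is the value of $u$ that falsifies the literal of $u$ in $A$, or $b_u=*$ if $u$ does not occur in $A$. * *Resolution:* from $(C_0,\{M_0^u\})$, $(C_1,\{M_1^u\})$ and an existential pivot $x$ with $x\in C_0$, $\overline x\in C_1$, derive $(\mathrm{res}(C_0,C_1,x),\{M^u\})$, where for each $u$ one of the following holds: $M_a^u$ is trivial and $M^u=M_{1-a}^u$ for some $a\in\{0,1\}$; or $M^u=M_0^u\simeq M_1^u$; or $x$ is left of $u$, $M_0^u,M_1^u$ are consistent, and $M^u$ is $M_0^u\cup M_1^u$ plus a new leading instruction "if $x=0$ go to the leading line of $M_0^u$ else go to the leading line of $M_1^u$" with a number larger than all others. A refutation is a derivation ending in a line with empty clause; its size is the number of lines. **QURes.** Lines are clauses. Rules: derive a non-tautological clause of $\phi$; resolution over any existential or universal pivot, provided the resolvent is not tautological; from $C$ derive $C\setminus\{\ell\}$ if $\ell\in C$ is a literal of a universal variable $u$ and all existential variables of $C$ are left of $u$. A refutation ends in the empty clause; its size is the number of clauses.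 **CP+∀Red.** Lines are integer inequalities $\sum_z a_z z\ge b$. Rules: for $A\in\phi$ the inequality $\sum_{z\in A}z+\sum_{\overline z\in A}(1-z)\ge1$; $z\ge0$ and $-z\ge-1$; addition; multiplication by a positive integer; division by an integer $c>0$ that divides all coefficients, with right-hand side $\lceil b/c\rceil$; and, if $u$ is universal, $a_u\ne0$, and all existential variables with nonzero coefficient are left of $u$, replacing $u$ by $0$ if $a_u>0$ and by $1$ if $a_u<0$. A refutation ends in $0\ge1$. Its size is measured either by the number of lines or by the total length of the lines with numbers written in binary (each occurrence of a variable name or relation sign counting as one symbol); all claims below hold for both measures. **Formulas.** For $n>1$, $\text{KBKF-lq}[n]$ has prefix $\exists d_1,e_1\forall x_1\cdots\exists d_n,e_n\forall x_n\exists f_1,\dots,f_n$ and clauses $\{\overline{d_1},\overline{e_1},\overline{f_1},\dots,\overline{f_n}\}$; for $i<n$, $\{d_i,x_i,\overline{d_{i+1}},\overline{e_{i+1}},\overline{f_1},\dots,\overline{f_n}\}$ and $\{e_i,\overline{x_i},\overline{d_{i+1}},\overline{e_{i+1}},\overline{f_1},\dots,\overline{f_n}\}$; $\{d_n,x_n,\overline{f_1},\dots,\overline{f_n}\}$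 and $\{e_n,\overline{x_n},\overline{f_1},\dots,\overline{f_n}\}$; for $i\le n$, $\{x_i,f_i,\overline{f_{i+1}},\dots,\overline{f_n}\}$ and $\{\overline{x_i},f_i,\overline{f_{i+1}},\dots,\overline{f_n}\}$. The $n$th Equality formula has prefix $\exists x_1,\dots,x_n\forall u_1,\dots,u_n\exists t_1,\dots,t_n$ and clauses $\{x_i,u_i,t_i\}$, $\{\overline{x_i},\overline{u_i},t_i\}$ for $i\in[n]$, and $\{\overline{t_1},\dots,\overline{t_n}\}$. **Terminology.** A system $P$ *simulates* $Q$ if there is a polynomial $p$ such that every QBF with a $Q$-refutation of size $s$ has a $P$-refutation of size at most $p(s)$; two systems are *incomparable* if neither simulates the other. A family $(\Phi_n)$ is *easy* for $P$ if $\Phi_n$ has $P$-refutations of size polynomial in $n$, and *hard* for $P$ if all $P$-refutations of $\Phi_n$ have size $2^{\Omega(n)}$. **Corollary 5.9.** MRes is incomparable with QURes and with CP+∀Red. More precisely: 1. $\text{KBKF-lq}[n]$ is hard for MRes, but easy for QURes and for CP+∀Red; moreover, CP+∀Red simulates QURes. 2. The Equality formulas are easy for MRes, but hard for QURes and for CP+∀Red.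 -/

import Mathlib

namespace QProof

/-! ## Quantified Boolean formulas -/

/-- A literal over `V`: `(z, true)` is the variable `z`, `(z, false)` is its negation. -/
abbrev Lit (V : Type) : Type := V × Bool

/-- A clause is a finite set of literals. -/
abbrev Clause (V : Type) : Type := Finset (Lit V)

/-- A clause is tautological if it contains a variable together with its negation. -/
def Taut {V : Type} (C : Clause V) : Prop := ∃ z : V, (z, true) ∈ C ∧ (z, false) ∈ C

/-- The resolvent of `C ∋ z` and `D ∋ ¬z` over the pivot `z`. -/
def resolvent {V : Type} [DecidableEq V] (C D : Clause V) (z : V) : Clause V :=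
  C.erase (z, true) ∪ D.erase (z, false)

/-- A QBF in prenex conjunctive normal form with variable set `V`.  The prefix
`∃ Z₀ ∀ Z₁ ∃ Z₂ ∀ Z₃ ⋯` is given by the block index `level z` of each variable, so that the blocks
with an even index are existential and those with an odd index universal
(blocks may be empty; `Z₀` is if the formula starts with a universal quantifier). -/
structure QBF (V : Type) where
  level : V → ℕ
  matrix : Finset (Clause V)

namespace QBF

variable {V : Type}

/-- `z` is existentially quantified. -/
abbrev IsEx (Φ : QBF V) (z : V) : Prop := Even (Φ.level z)

/-- `z` is universally quantified. -/
abbrev IsUniv (Φ : QBF V) (z : V) : Prop := Odd (Φ.level z)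

/-- `z` is left of `z'` in the quantifier prefix. -/
def LeftOf (Φ : QBF V) (z z' : V) : Prop := Φ.level z < Φ.level z'

/-- The existential part of a clause. -/
def exPart (Φ : QBF V) (C : Clause V) : Clause V := C.filter fun l => Φ.IsEx l.1

end QBF

/-! ## Line-based derivations and sized proof systems -/

/-- `Derivation step π`: the list `π`, read from its last entry to its head, is a derivation, i.e.
every line follows by `step` from the lines before it.  The head of `π` is the final line. -/
inductive Derivation {L : Type} (step : List L → L → Prop) : List L → Prop
  | nil : Derivation step []
  | cons {π : List L} {l : L} : Derivation step π → step π l → Derivation step (l :: π)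

/-- A QBF proof system together with a size measure, recorded as the relation
`S V Φ s`: "the QBF `Φ` over the variables `V` has an `S`-refutation of size `s`". -/
abbrev SizedSystem : Type 1 :=
  (V : Type) → [DecidableEq V] → [Fintype V] → QBF V → ℕ → Prop

/-- `P` simulates `Q`: every `Q`-refutation can be replaced by a `P`-refutation of the same formula
with at most a polynomial increase in size. -/
def Simulates (P Q : SizedSystem) : Prop :=
  ∃ p : Polynomial ℕ, ∀ (V : Type) [DecidableEq V] [Fintype V] (Φ : QBF V) (s : ℕ),
    Q V Φ s → ∃ t ≤ p.eval s, P V Φ t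

/-- Neither of the two systems simulates the other. -/
def Incomparable (P Q : SizedSystem) : Prop := ¬ Simulates P Q ∧ ¬ Simulates Q P

section Families

variable {V : ℕ → Type} [∀ n, DecidableEq (V n)] [∀ n, Fintype (V n)]

/-- The family `F` is easy for `S`: it has refutations of size polynomial in `n`. -/
def Easy (S : SizedSystem) (F : (n : ℕ) → QBF (V n)) : Prop :=
  ∃ p : Polynomial ℕ, ∀ n : ℕ, ∃ s ≤ p.eval n, S (V n) (F n) s

/-- The family `F` is (exponentially) hard for `S`: every refutation has size `2 ^ Ω(n)`. -/
def Hard (S : SizedSystem) (F : (n : ℕ) → QBF (V n)) : Prop :=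
  ∃ c : ℝ, 0 < c ∧ ∀ᶠ n : ℕ in Filter.atTop,
    ∀ s : ℕ, S (V n) (F n) s → (2 : ℝ) ^ (c * (n : ℝ)) ≤ (s : ℝ)

end Families

/-! ## Merge Resolution -/

/-- Instructions of merge maps: output `b ∈ {*, 0, 1}` (`none` stands for the undefined value `*`),
or "if `x = 0` then go to line `l₀` else go to line `l₁`". -/
inductive Instr (V : Type) : Type
  | out (b : Option Bool)
  | branch (x : V) (l₀ l₁ : ℕ)
  deriving DecidableEq

/-- Renaming of the line numbers an instruction refers to. -/
def Instr.rename {V : Type} (σ : ℕ → ℕ) : Instr V → Instr V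
  | .out b => .out b
  | .branch x l₀ l₁ => .branch x (σ l₀) (σ l₁)

/-- A merge map (a deterministic branching program): a finite set of numbered instructions,
started at its largest line number. -/
abbrev MergeMap (V : Type) : Type := Finset (ℕ × Instr V)

namespace MergeMap

variable {V : Type}

/-- The simple merge map `⟨i⟩: b`. -/
def simple (i : ℕ) (b : Option Bool) : MergeMap V := {(i, Instr.out b)}

/-- A merge map is trivial if it consists of a single instruction with output `*`. -/
def Trivial (M : MergeMap V) : Prop := ∃ i : ℕ, M = simple i none

/-- The number of the leading instruction (the largest line number). -/
def lead (M : MergeMap V) : ℕ := M.sup Prod.fst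

/-- `M₀ ⋈ M₁`: instructions with the same line number are identical. -/
def Consistent (M₀ M₁ : MergeMap V) : Prop := ∀ p ∈ M₀, ∀ q ∈ M₁, p.1 = q.1 → p = q

/-- `M₀ ≃ M₁`: some bijective renumbering of the lines transforms `M₀` into `M₁`
(a bijection between two finite sets of numbers extends to a permutation of `ℕ`). -/
def Iso [DecidableEq V] (M₀ M₁ : MergeMap V) : Prop :=
  ∃ σ : Equiv.Perm ℕ, M₁ = M₀.image fun p => (σ p.1, p.2.rename σ)

/-- `M` is a merge of the (consistent) maps `M₀` and `M₁`: it has a new leading instruction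
"if `x = 0` then `⟨M₀⟩` else `⟨M₁⟩`". -/
def IsMerge [DecidableEq V] (x : V) (M₀ M₁ M : MergeMap V) : Prop :=
  Consistent M₀ M₁ ∧ ∃ l : ℕ, (∀ p ∈ M₀ ∪ M₁, p.1 < l) ∧
    M = insert (l, Instr.branch x (lead M₀) (lead M₁)) (M₀ ∪ M₁)

end MergeMap

/-- The value that `u` must take to falsify the (non-tautological) clause `A`;
`*` if `u` does not occur in `A`. -/
def falsifyingValue {V : Type} [DecidableEq V] (A : Clause V) (u : V) : Option Bool :=
  if (u, true) ∈ A then some false else if (u, false) ∈ A then some true else none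

/-- A line of Merge Resolution: a clause and a merge map for every universal variable. -/
structure MLine {V : Type} (Φ : QBF V) : Type where
  clause : Clause V
  map : {u : V // Φ.IsUniv u} → MergeMap V

/-- The rules of Merge Resolution: `MResStep Φ π L` says that `L` follows from lines in `π`. -/
inductive MResStep {V : Type} [DecidableEq V] (Φ : QBF V) (π : List (MLine Φ)) : MLine Φ → Prop
  | download (A : Clause V) (i : ℕ) : A ∈ Φ.matrix → ¬ Taut A →
      MResStep Φ π ⟨Φ.exPart A, fun u => MergeMap.simple i (falsifyingValue A u.1)⟩
  | res (L₀ L₁ : MLine Φ) (x : V) (M : {u : V // Φ.IsUniv u} → MergeMap V) :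
      L₀ ∈ π → L₁ ∈ π → Φ.IsEx x → (x, true) ∈ L₀.clause → (x, false) ∈ L₁.clause →
      (∀ u, ((L₀.map u).Trivial ∧ M u = L₁.map u) ∨
        ((L₁.map u).Trivial ∧ M u = L₀.map u) ∨
        (M u = L₀.map u ∧ (L₀.map u).Iso (L₁.map u)) ∨
        (Φ.LeftOf x u.1 ∧ MergeMap.IsMerge x (L₀.map u) (L₁.map u) (M u))) →
      MResStep Φ π ⟨resolvent L₀.clause L₁.clause x, M⟩

/-- Merge Resolution.  A refutation ends in a line with the empty clause; its size is the number
of lines. -/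
def MRes : SizedSystem := fun _ _ _ Φ s =>
  ∃ (π : List (MLine Φ)) (L : MLine Φ), Derivation (MResStep Φ) (L :: π) ∧
    L.clause = ∅ ∧ s = (L :: π).length

/-! ## QU-Resolution -/

/-- The rules of QU-Resolution: clauses of the matrix, resolution over existential or universal
pivots with non-tautological resolvent, and universal reduction, which removes a universal literal
that has no existential variable of the clause in its block or to its right. -/
inductive QUResStep {V : Type} [DecidableEq V] (Φ : QBF V) (π : List (Clause V)) :
    Clause V → Prop
  | download (A : Clause V) : A ∈ Φ.matrix → ¬ Taut A → QUResStep Φ π A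
  | res (C D : Clause V) (z : V) : C ∈ π → D ∈ π → (z, true) ∈ C → (z, false) ∈ D →
      ¬ Taut (resolvent C D z) → QUResStep Φ π (resolvent C D z)
  | red (C : Clause V) (l : Lit V) : C ∈ π → l ∈ C → Φ.IsUniv l.1 →
      (∀ k ∈ C, Φ.IsEx k.1 → Φ.LeftOf k.1 l.1) → QUResStep Φ π (C.erase l)

/-- QU-Resolution.  A refutation ends in the empty clause; its size is the number of clauses. -/
def QURes : SizedSystem := fun V _ _ Φ s =>
  ∃ π : List (Clause V), Derivation (QUResStep Φ) (∅ :: π) ∧ s = (∅ :: π).length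

/-! ## Cutting Planes with universal reduction -/

/-- The linear inequality `∑ z, coeff z * z ≥ rhs` with integer coefficients. -/
@[ext] structure LinIneq (V : Type) : Type where
  coeff : V → ℤ
  rhs : ℤ

/-- The inequality `∑ (z ∈ C) z + ∑ (¬z ∈ C) (1 - z) ≥ 1` that encodes the clause `C`. -/
def clauseIneq {V : Type} [DecidableEq V] (C : Clause V) : LinIneq V where
  coeff z := (if (z, true) ∈ C then 1 else 0) - (if (z, false) ∈ C then 1 else 0)
  rhs := 1 - ((C.filter fun l => l.2 = false).card : ℤ)

/-- The rules of CP+∀Red: inequalities of the clauses of the matrix, Boolean axioms `z ≥ 0` and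
`-z ≥ -1`, addition, multiplication by a positive integer, division with rounding, and universal
reduction.  The latter applies to a universal variable `u` such that all existential variables with
nonzero coefficient are left of `u`, and replaces `u` by `0` if its coefficient is positive and by
`1` if it is negative. -/
inductive CPRedStep {V : Type} [DecidableEq V] (Φ : QBF V) (π : List (LinIneq V)) :
    LinIneq V → Prop
  | download (A : Clause V) : A ∈ Φ.matrix → CPRedStep Φ π (clauseIneq A)
  | lower (z : V) : CPRedStep Φ π ⟨Pi.single z 1, 0⟩
  | upper (z : V) : CPRedStep Φ π ⟨Pi.single z (-1), -1⟩
  | add (I J : LinIneq V) : I ∈ π → J ∈ π → CPRedStep Φ π ⟨I.coeff + J.coeff, I.rhs + J.rhs⟩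
  | mult (I : LinIneq V) (c : ℤ) : I ∈ π → 0 < c → CPRedStep Φ π ⟨c • I.coeff, c * I.rhs⟩
  | div (I : LinIneq V) (c : ℤ) (a : V → ℤ) : I ∈ π → 0 < c → I.coeff = c • a →
      CPRedStep Φ π ⟨a, ⌈(I.rhs : ℚ) / (c : ℚ)⌉⟩
  | redPos (I : LinIneq V) (u : V) : I ∈ π → Φ.IsUniv u →
      (∀ x, Φ.IsEx x → I.coeff x ≠ 0 → Φ.LeftOf x u) → 0 < I.coeff u →
      CPRedStep Φ π ⟨Function.update I.coeff u 0, I.rhs⟩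
  | redNeg (I : LinIneq V) (u : V) : I ∈ π → Φ.IsUniv u →
      (∀ x, Φ.IsEx x → I.coeff x ≠ 0 → Φ.LeftOf x u) → I.coeff u < 0 →
      CPRedStep Φ π ⟨Function.update I.coeff u 0, I.rhs - I.coeff u⟩

/-- `π` is a CP+∀Red refutation of `Φ`: a derivation whose final line is `0 ≥ 1`. -/
def IsCPRedRefutation {V : Type} [DecidableEq V] (Φ : QBF V) (π : List (LinIneq V)) : Prop :=
  Derivation (CPRedStep Φ) π ∧ π.head? = some ⟨0, 1⟩

/-- The length of the written inequality: one symbol for the relation sign, the right-hand side in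
binary, and for every occurring variable its name and its coefficient in binary. -/
def LinIneq.length {V : Type} [Fintype V] (I : LinIneq V) : ℕ :=
  1 + Nat.size I.rhs.natAbs + ∑ z with I.coeff z ≠ 0, (1 + Nat.size (I.coeff z).natAbs)

/-- CP+∀Red, with the number of lines as size. -/
def CPRed : SizedSystem := fun V _ _ Φ s =>
  ∃ π : List (LinIneq V), IsCPRedRefutation Φ π ∧ s = π.length

/-- CP+∀Red, with the total length of all lines (coefficients in binary) as size. -/
def CPRedBits : SizedSystem := fun V _ _ Φ s =>
  ∃ π : List (LinIneq V), IsCPRedRefutation Φ π ∧ s = (π.map LinIneq.length).sum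

/-! ## The formulas

The indices `1, …, n` of the variables are represented by the elements `0, …, n - 1` of `Fin n`. -/

inductive KBKFKind : Type
  | d | e | x | f
  deriving DecidableEq

instance : Fintype KBKFKind where
  elems := {.d, .e, .x, .f}
  complete k := by cases k <;> simp

/-- The variables `d_i, e_i, x_i, f_i` of `KBKF-lq[n]`. -/
abbrev KBKFVar (n : ℕ) : Type := KBKFKind × Fin n

namespace KBKF

/-- The literals `¬d_k, ¬e_k` (none if the index `k` is out of range). -/
def negDE (n k : ℕ) : Clause (KBKFVar n) :=
  (Finset.univ.filter fun j : Fin n => (j : ℕ) = k).biUnion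
    fun j => {((.d, j), false), ((.e, j), false)}

/-- The literals `¬f_j` with index `j ≥ k`. -/
def negF (n k : ℕ) : Clause (KBKFVar n) :=
  (Finset.univ.filter fun j : Fin n => k ≤ (j : ℕ)).image fun j => ((.f, j), false)

/-- The clause `{¬d_1, ¬e_1, ¬f_1, …, ¬f_n}`. -/
def clauseA (n : ℕ) : Clause (KBKFVar n) := negDE n 0 ∪ negF n 0

/-- The clauses `{d_i, x_i, ¬d_{i+1}, ¬e_{i+1}, ¬f_1, …, ¬f_n}`; for `i = n` the literals with
index `i + 1` are absent. -/
def clauseAd {n : ℕ} (i : Fin n) : Clause (KBKFVar n) :=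
  {((.d, i), true), ((.x, i), true)} ∪ negDE n (i + 1) ∪ negF n 0

/-- The clauses `{e_i, ¬x_i, ¬d_{i+1}, ¬e_{i+1}, ¬f_1, …, ¬f_n}`; for `i = n` the literals with
index `i + 1` are absent. -/
def clauseAe {n : ℕ} (i : Fin n) : Clause (KBKFVar n) :=
  {((.e, i), true), ((.x, i), false)} ∪ negDE n (i + 1) ∪ negF n 0

/-- The clauses `{x_i, f_i, ¬f_{i+1}, …, ¬f_n}` (`b = true`) and
`{¬x_i, f_i, ¬f_{i+1}, …, ¬f_n}` (`b = false`). -/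
def clauseB {n : ℕ} (b : Bool) (i : Fin n) : Clause (KBKFVar n) :=
  {((.x, i), b), ((.f, i), true)} ∪ negF n (i + 1)

/-- The block of each variable in `∃ d_1 e_1 ∀ x_1 ⋯ ∃ d_n e_n ∀ x_n ∃ f_1 ⋯ f_n`. -/
def level {n : ℕ} : KBKFVar n → ℕ
  | (.d, i) => 2 * i
  | (.e, i) => 2 * i
  | (.x, i) => 2 * i + 1
  | (.f, _) => 2 * n

end KBKF

/-- The formula `KBKF-lq[n]`. -/
def KBKFlq (n : ℕ) : QBF (KBKFVar n) where
  level := KBKF.level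
  matrix := {KBKF.clauseA n} ∪ Finset.univ.image KBKF.clauseAd ∪ Finset.univ.image KBKF.clauseAe ∪
    Finset.univ.image (KBKF.clauseB true) ∪ Finset.univ.image (KBKF.clauseB false)

inductive EqualityKind : Type
  | x | u | t
  deriving DecidableEq

instance : Fintype EqualityKind where
  elems := {.x, .u, .t}
  complete k := by cases k <;> simp

/-- The variables `x_i, u_i, t_i` of the `n`th Equality formula. -/
abbrev EqualityVar (n : ℕ) : Type := EqualityKind × Fin n

/-- The `n`th Equality formula: prefix `∃ x_1 ⋯ x_n ∀ u_1 ⋯ u_n ∃ t_1 ⋯ t_n` and clauses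
`{x_i, u_i, t_i}`, `{¬x_i, ¬u_i, t_i}` for all `i`, and `{¬t_1, …, ¬t_n}`. -/
def Equality (n : ℕ) : QBF (EqualityVar n) where
  level
    | (.x, _) => 0
    | (.u, _) => 1
    | (.t, _) => 2
  matrix :=
    (Finset.univ.image fun i : Fin n =>
      ({((.x, i), true), ((.u, i), true), ((.t, i), true)} : Clause (EqualityVar n))) ∪
    (Finset.univ.image fun i : Fin n =>
      ({((.x, i), false), ((.u, i), false), ((.t, i), true)} : Clause (EqualityVar n))) ∪
    {Finset.univ.image fun i : Fin n => ((.t, i), false)}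

end QProof

namespace QProof

/-! Hardness passes from a system to every system it simulates, easiness passes in the other
direction, and no easy family is hard. So two lower bounds, two upper bounds and the simulation of
QU-Resolution by CP+∀Red give everything.

Equality is hard for CP+∀Red (`exists_response_eq`). A line without `t`-variables determines a
universal response, the one minimizing its left-hand side. If no such line had response `α`, then
every such line would hold whenever the `x`-block is set to `α`: a response different from `α`
leaves the matrix satisfiable, so the line holds at its own minimum. This fails for `0 ≥ 1`, so all
`2 ^ n` responses occur, on distinct lines. Merge Resolution instead merges the constants `0` and
`1` into the map `u_i = x_i` once per index (`unitLine_step`, `tailLine_succ_step`).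

CP+∀Red performs a resolution step by adding the premises, padding with Boolean axioms up to twice
the resolvent, and dividing by 2 (`exists_resolvent`). KBKF-lq is easy for QU-Resolution since
resolving on the universal `x_i` makes every `f_i` a unit clause, after which all `d_i` and `e_i`
become units too.

KBKF-lq is hard for Merge Resolution because every `α` forces a line whose map for each `x_k` is the
constant `α k` (`exists_constant_line`). The variables `f_j` lie right of all `x_k`, so a step over
`f_j` cannot merge. Moreover a line containing `f_j` has a nontrivial constant map for `x_j`. Hence
a negated `f_j` can be removed only while the relevant maps are still constant. On the other hand a
line with trivial map for `x_k` still contains the negated `f_k` (`NegLine`). Following the path of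
`α` from the empty clause towards the axioms, consider the first line whose maps are all constant:
the two facts exclude trivial maps there, and falsification by `α` fixes the values. -/

/-! ### Transfer of hardness and easiness along simulations. -/

/-- The bound is monotone in `s`, so it composes with other bounds, and the shift to `s + 1` makes
every lower power at most the top one, also at `s = 0`. -/
theorem exists_eval_le_mul_pow (p : Polynomial ℕ) :
    ∃ K d : ℕ, ∀ s : ℕ, p.eval s ≤ K * (s + 1) ^ d := by
  refine ⟨∑ i ∈ Finset.range (p.natDegree + 1), p.coeff i, p.natDegree, fun s => ?_⟩
  rw [Polynomial.eval_eq_sum_range, Finset.sum_mul]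
  refine Finset.sum_le_sum fun i hi => ?_
  have hi' : i ≤ p.natDegree := Nat.lt_succ_iff.mp (Finset.mem_range.mp hi)
  exact Nat.mul_le_mul_left _ <| (Nat.pow_le_pow_left (Nat.le_succ s) i).trans (Nat.pow_le_pow_right (Nat.succ_pos s) hi')

theorem tendsto_two_rpow {c : ℝ} (hc : 0 < c) :
    Filter.Tendsto (fun n : ℕ => (2 : ℝ) ^ (c * (n : ℝ))) Filter.atTop Filter.atTop := by
  have h : (1 : ℝ) < 2 ^ c := Real.one_lt_rpow (by norm_num) hc
  refine (tendsto_pow_atTop_atTop_of_one_lt h).congr fun n => ?_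
  rw [Real.rpow_mul (by norm_num), Real.rpow_natCast]

section Families

variable {V : ℕ → Type} [∀ n, DecidableEq (V n)] [∀ n, Fintype (V n)]

theorem Hard.of_simulates {P Q : SizedSystem} {F : (n : ℕ) → QBF (V n)}
    (hF : Hard P F) (hPQ : Simulates P Q) : Hard Q F := by
  obtain ⟨c, hc, hev⟩ := hF
  obtain ⟨p, hp⟩ := hPQ
  obtain ⟨K, d, hK⟩ := exists_eval_le_mul_pow p
  have hd : (0 : ℝ) < d + 1 := by positivity
  -- With this exponent `y ^ (d + 1)` is the square root of `2 ^ (c * n)`. A size below `y` would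
  -- give a `P`-refutation of size at most a constant times that square root, too small for large
  -- `n`. Using `d + 1` instead of `d` avoids dividing by zero.
  refine ⟨c / (2 * (d + 1)), by positivity, ?_⟩
  filter_upwards [hev, (tendsto_two_rpow (half_pos hc)).eventually_gt_atTop ((K : ℝ) * 2 ^ (d + 1))]
    with n hn hbig s hs
  obtain ⟨t, ht, hPt⟩ := hp (V n) (F n) s hs
  have h2 := hn t hPt
  by_contra! hlt
  set y : ℝ := (2 : ℝ) ^ (c / (2 * ((d : ℝ) + 1)) * (n : ℝ)) with hy
  have hy1 : 1 ≤ y := Real.one_le_rpow (by norm_num) (by positivity)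
  have hyd : y ^ (d + 1) = (2 : ℝ) ^ (c / 2 * (n : ℝ)) := by
    rw [hy, ← Real.rpow_natCast, ← Real.rpow_mul (by norm_num)]
    congr 1
    push_cast
    field_simp
  have hsplit : (2 : ℝ) ^ (c * (n : ℝ)) = 2 ^ (c / 2 * (n : ℝ)) * 2 ^ (c / 2 * (n : ℝ)) := by
    rw [← Real.rpow_add (by norm_num)]
    congr 1
    ring
  have ht' : (t : ℝ) ≤ K * ((s : ℝ) + 1) ^ d := by exact_mod_cast ht.trans (hK s)
  have hs1 : (1 : ℝ) ≤ (s : ℝ) + 1 := by linarith [Nat.cast_nonneg (α := ℝ) s]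
  have h3 : (K : ℝ) * ((s : ℝ) + 1) ^ d ≤ K * (2 ^ (d + 1) * y ^ (d + 1)) := by
    rw [← mul_pow]
    gcongr
    calc ((s : ℝ) + 1) ^ d ≤ ((s : ℝ) + 1) ^ (d + 1) := pow_le_pow_right₀ hs1 (Nat.le_succ d)
      _ ≤ (2 * y) ^ (d + 1) := by gcongr; linarith
  have hz : (0 : ℝ) < 2 ^ (c / 2 * (n : ℝ)) := by positivity
  rw [hyd] at h3
  rw [hsplit] at h2
  nlinarith

theorem Easy.not_hard {P : SizedSystem} {F : (n : ℕ) → QBF (V n)} (hF : Easy P F) :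
    ¬ Hard P F := by
  rintro ⟨c, hc, hev⟩
  obtain ⟨p, hp⟩ := hF
  obtain ⟨K, d, hK⟩ := exists_eval_le_mul_pow p
  have h1 : (1 : ℝ) < 2 ^ c := Real.one_lt_rpow (by norm_num) hc
  -- The constant is chosen so that `K * 2 ^ d * n ^ d`, which bounds `K * (n + 1) ^ d` for `n ≥ 1`,
  -- stays below half of `(2 ^ c) ^ n`.
  have ho := (isLittleO_pow_const_const_pow_of_one_lt (R := ℝ) d h1).def
    (show (0 : ℝ) < 1 / (2 * (K * 2 ^ d + 1)) by positivity)
  obtain ⟨n, hn, hn', hn1⟩ := (hev.and (ho.and (Filter.eventually_ge_atTop 1))).exists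
  obtain ⟨s, hs, hPs⟩ := hp n
  have h2 := hn s hPs
  have h3 : (s : ℝ) ≤ K * ((n : ℝ) + 1) ^ d := by exact_mod_cast hs.trans (hK n)
  have hn1' : (1 : ℝ) ≤ n := by exact_mod_cast hn1
  have h4 : (K : ℝ) * ((n : ℝ) + 1) ^ d ≤ K * (2 ^ d * (n : ℝ) ^ d) := by
    rw [← mul_pow]
    gcongr
    linarith
  have h5 : (2 : ℝ) ^ (c * (n : ℝ)) = (2 ^ c) ^ n := by
    rw [Real.rpow_mul (by norm_num), Real.rpow_natCast]
  rw [h5] at h2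
  rw [Real.norm_of_nonneg (by positivity), Real.norm_of_nonneg (by positivity), div_mul_eq_mul_div,
    one_mul, le_div_iff₀ (by positivity)] at hn'
  have h6 : (0 : ℝ) < (2 ^ c) ^ n := by positivity
  have h7 : (0 : ℝ) ≤ (n : ℝ) ^ d := by positivity
  nlinarith

theorem Easy.of_simulates {P Q : SizedSystem} {F : (n : ℕ) → QBF (V n)}
    (hF : Easy Q F) (hPQ : Simulates P Q) : Easy P F := by
  obtain ⟨p, hp⟩ := hF
  obtain ⟨q, hq⟩ := hPQ
  obtain ⟨K, d, hK⟩ := exists_eval_le_mul_pow q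
  refine ⟨Polynomial.C K * (p + 1) ^ d, fun n => ?_⟩
  obtain ⟨s, hs, hQ⟩ := hp n
  obtain ⟨t, ht, hP⟩ := hq _ _ s hQ
  refine ⟨t, (ht.trans (hK s)).trans ?_, hP⟩
  simp only [Polynomial.eval_mul, Polynomial.eval_C, Polynomial.eval_pow, Polynomial.eval_add,
    Polynomial.eval_one]
  gcongr

theorem not_simulates {P Q : SizedSystem} {F : (n : ℕ) → QBF (V n)}
    (hP : Hard P F) (hQ : Easy Q F) : ¬ Simulates P Q :=
  fun h => hQ.not_hard (hP.of_simulates h)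

end Families

/-! ### Soundness of the cutting planes rules at 0-1 assignments. -/

section Semantics

variable {V : Type} [Fintype V]

/-- The inequality `I` holds at the 0-1 assignment `σ`. -/
def LinIneq.Holds (I : LinIneq V) (σ : V → Bool) : Prop :=
  I.rhs ≤ ∑ z, I.coeff z * (σ z).toInt

variable [DecidableEq V]

theorem card_filter_neg (C : Clause V) :
    ((C.filter fun l => l.2 = false).card : ℤ) = ∑ z, if (z, false) ∈ C then 1 else 0 := by
  rw [Finset.sum_boole]
  congr 1
  refine Finset.card_bij' (fun l _ => l.1) (fun z _ => (z, false)) ?_ ?_ ?_ ?_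
  · rintro ⟨z, b⟩ h
    simp only [Finset.mem_filter] at h
    obtain ⟨h, rfl⟩ := h
    simpa using h
  · intro z h
    simpa using h
  · rintro ⟨z, b⟩ h
    simp only [Finset.mem_filter] at h
    simp [h.2]
  · simp

theorem clauseIneq_holds {C : Clause V} {σ : V → Bool} {l : Lit V} (hl : l ∈ C)
    (hσ : σ l.1 = l.2) : (clauseIneq C).Holds σ := by
  have key : (1 : ℤ) ≤ ∑ z, ((if (z, true) ∈ C then (σ z).toInt else 0) +
      (if (z, false) ∈ C then 1 - (σ z).toInt else 0)) := by
    have hnn : ∀ z ∈ Finset.univ, (0 : ℤ) ≤ (if (z, true) ∈ C then (σ z).toInt else 0) +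
        (if (z, false) ∈ C then 1 - (σ z).toInt else 0) := by
      intro z _
      cases σ z <;> simp <;> split_ifs <;> simp
    refine le_trans ?_ (Finset.single_le_sum hnn (Finset.mem_univ l.1))
    obtain ⟨z, b⟩ := l
    simp only at hσ
    subst hσ
    cases h : σ z <;> rw [h] at hl <;> simp [hl]
  simp only [LinIneq.Holds, clauseIneq, card_filter_neg]
  rw [sub_le_iff_le_add, ← Finset.sum_add_distrib]
  refine key.trans (Finset.sum_le_sum fun z _ => ?_)
  split_ifs <;> cases σ z <;> simp

theorem LinIneq.Holds.add {I J : LinIneq V} {σ : V → Bool} (hI : I.Holds σ) (hJ : J.Holds σ) :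
    LinIneq.Holds ⟨I.coeff + J.coeff, I.rhs + J.rhs⟩ σ := by
  simp only [LinIneq.Holds, Pi.add_apply, add_mul, Finset.sum_add_distrib] at *
  exact add_le_add hI hJ

theorem LinIneq.Holds.mult {I : LinIneq V} {σ : V → Bool} (hI : I.Holds σ) {c : ℤ} (hc : 0 < c) :
    LinIneq.Holds ⟨c • I.coeff, c * I.rhs⟩ σ := by
  simp only [LinIneq.Holds, Pi.smul_apply, smul_eq_mul, mul_assoc, ← Finset.mul_sum] at *
  exact mul_le_mul_of_nonneg_left hI hc.le

theorem LinIneq.Holds.div {I : LinIneq V} {σ : V → Bool} (hI : I.Holds σ) {c : ℤ} (hc : 0 < c)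
    {a : V → ℤ} (ha : I.coeff = c • a) : LinIneq.Holds ⟨a, ⌈(I.rhs : ℚ) / (c : ℚ)⌉⟩ σ := by
  simp only [LinIneq.Holds, ha, Pi.smul_apply, smul_eq_mul, mul_assoc, ← Finset.mul_sum] at *
  rw [Int.ceil_le, div_le_iff₀ (by exact_mod_cast hc), mul_comm]
  exact_mod_cast hI

theorem sum_update_mul (a : V → ℤ) (u : V) (v : ℤ) (σ : V → Bool) :
    ∑ z, Function.update a u v z * (σ z).toInt =
      ∑ z, a z * (σ z).toInt + (v - a u) * (σ u).toInt := by
  rw [← Finset.add_sum_erase _ _ (Finset.mem_univ u),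
    ← Finset.add_sum_erase _ (fun z => a z * (σ z).toInt) (Finset.mem_univ u)]
  have : ∑ z ∈ Finset.univ.erase u, Function.update a u v z * (σ z).toInt =
      ∑ z ∈ Finset.univ.erase u, a z * (σ z).toInt :=
    Finset.sum_congr rfl fun z hz => by
      rw [Function.update_of_ne (Finset.ne_of_mem_erase hz)]
  rw [this, Function.update_self]
  ring

theorem sum_mul_update (a : V → ℤ) (u : V) (b : Bool) (σ : V → Bool) :
    ∑ z, a z * (Function.update σ u b z).toInt =
      ∑ z, a z * (σ z).toInt + a u * (b.toInt - (σ u).toInt) := by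
  rw [← Finset.add_sum_erase _ _ (Finset.mem_univ u),
    ← Finset.add_sum_erase _ (fun z => a z * (σ z).toInt) (Finset.mem_univ u)]
  have : ∑ z ∈ Finset.univ.erase u, a z * (Function.update σ u b z).toInt =
      ∑ z ∈ Finset.univ.erase u, a z * (σ z).toInt :=
    Finset.sum_congr rfl fun z hz => by
      rw [Function.update_of_ne (Finset.ne_of_mem_erase hz)]
  rw [this, Function.update_self]
  ring

end Semantics

/-! ### The Equality formulas are hard for CP+∀Red -/

section EqualityHard

variable {n : ℕ}

/-- The assignment given by its restrictions to the three blocks. -/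
def eqAsg (α β τ : Fin n → Bool) : EqualityVar n → Bool
  | (.x, i) => α i
  | (.u, i) => β i
  | (.t, i) => τ i

/-- No `t`-variable occurs in the inequality. -/
def TFree (I : LinIneq (EqualityVar n)) : Prop := ∀ i, I.coeff (.t, i) = 0

/-- The universal response that minimizes the left-hand side of an inequality. -/
def response (I : LinIneq (EqualityVar n)) (i : Fin n) : Bool := decide (I.coeff (.u, i) < 0)

theorem sum_equalityVar (g : EqualityVar n → ℤ) :
    ∑ z, g z = ∑ i, g (.x, i) + ∑ i, g (.u, i) + ∑ i, g (.t, i) := by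
  rw [Fintype.sum_prod_type]
  have : (Finset.univ : Finset EqualityKind) = {.x, .u, .t} := rfl
  rw [this]
  simp [add_assoc]

/-- The response minimizes each universal term separately, and the `t`-block contributes nothing. -/
theorem TFree.holds {I : LinIneq (EqualityVar n)} (hI : TFree I) {α τ : Fin n → Bool}
    (h : I.Holds (eqAsg α (response I) τ)) (β τ' : Fin n → Bool) : I.Holds (eqAsg α β τ') := by
  simp only [LinIneq.Holds, sum_equalityVar, eqAsg, hI _, zero_mul] at *
  refine h.trans ?_
  have : ∑ i, I.coeff (.u, i) * (response I i).toInt ≤ ∑ i, I.coeff (.u, i) * (β i).toInt := by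
    refine Finset.sum_le_sum fun i _ => ?_
    by_cases hi : I.coeff (.u, i) < 0 <;> cases β i <;> simp [response, hi] <;> omega
  linarith

/-- At an index where `β` and `α` differ, both clauses are satisfied without `t_i`. So `t_i = 0`
satisfies the long clause, and all other `t_j` can be 1. -/
theorem equality_sat_of_ne {α β : Fin n → Bool} (h : β ≠ α) :
    ∃ τ, ∀ A ∈ (Equality n).matrix, ∃ l ∈ A, eqAsg α β τ l.1 = l.2 := by
  obtain ⟨i, hi⟩ := Function.ne_iff.mp h
  refine ⟨fun j => decide (j ≠ i), fun A hA => ?_⟩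
  simp only [Equality, Finset.mem_union, Finset.mem_image, Finset.mem_univ, true_and,
    Finset.mem_singleton] at hA
  rcases hA with (⟨j, rfl⟩ | ⟨j, rfl⟩) | rfl
  · by_cases hj : j = i
    · subst hj
      cases hα : α j <;> cases hβ : β j <;> simp_all [eqAsg]
    · simp [eqAsg, hj]
  · by_cases hj : j = i
    · subst hj
      cases hα : α j <;> cases hβ : β j <;> simp_all [eqAsg]
    · simp [eqAsg, hj]
  · exact ⟨((.t, i), false), by simp, by simp [eqAsg]⟩

theorem eqAsg_eq (σ : EqualityVar n → Bool) :
    σ = eqAsg (fun i => σ (.x, i)) (fun i => σ (.u, i)) (fun i => σ (.t, i)) := by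
  funext ⟨k, i⟩
  cases k <;> rfl

theorem tFree_of_leftOf {I : LinIneq (EqualityVar n)} {u : EqualityVar n}
    (hu : (Equality n).IsUniv u)
    (h : ∀ x, (Equality n).IsEx x → I.coeff x ≠ 0 → (Equality n).LeftOf x u) : TFree I := by
  intro i
  by_contra hne
  have hlt := h (.t, i) (by simp [QBF.IsEx, Equality]) hne
  obtain ⟨k, j⟩ := u
  cases k <;> simp [QBF.LeftOf, QBF.IsUniv, Equality] at *

/-- Both claims are proved together. The first is ordinary soundness, except at a reduction step,
which needs the premise also after changing `u`. Reduction requires a `t`-free premise, and for such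
lines the second claim allows arbitrary `β`. The second follows from the first through the
minimizing response. -/
theorem exists_response_eq {π : List (LinIneq (EqualityVar n))}
    (hπ : Derivation (CPRedStep (Equality n)) π) (α : Fin n → Bool)
    (h : ∀ I ∈ π, TFree I → response I ≠ α) :
    (∀ I ∈ π, ∀ β τ, (∀ A ∈ (Equality n).matrix, ∃ l ∈ A, eqAsg α β τ l.1 = l.2) →
      I.Holds (eqAsg α β τ)) ∧ ∀ I ∈ π, TFree I → ∀ β τ, I.Holds (eqAsg α β τ) := by
  induction hπ with
  | nil => simp
  | @cons π I hπ hs ih =>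
    obtain ⟨ih1, ih2⟩ := ih fun I hI => h I (List.mem_cons_of_mem _ hI)
    -- Changing a universal variable keeps the `x`-block equal to `α`, so the second induction claim
    -- applies to the premise of a reduction.
    have ihu : ∀ J ∈ π, ∀ u, (Equality n).IsUniv u →
        (∀ x, (Equality n).IsEx x → J.coeff x ≠ 0 → (Equality n).LeftOf x u) →
        ∀ b β τ, J.Holds (Function.update (eqAsg α β τ) u b) := by
      intro J hJ u hu hl b β τ
      rw [eqAsg_eq (Function.update _ _ _)]
      have : (fun i => Function.update (eqAsg α β τ) u b (.x, i)) = α := by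
        funext i
        rw [Function.update_of_ne]
        · rfl
        · rintro rfl
          simp [QBF.IsUniv, Equality] at hu
      rw [this]
      exact ih2 J hJ (tFree_of_leftOf hu hl) _ _
    have h1 : ∀ β τ, (∀ A ∈ (Equality n).matrix, ∃ l ∈ A, eqAsg α β τ l.1 = l.2) →
        I.Holds (eqAsg α β τ) := by
      intro β τ hsat
      cases hs with
      | download A hA =>
        obtain ⟨l, hl, hσ⟩ := hsat A hA
        exact clauseIneq_holds hl hσ
      | lower z =>
        simp only [LinIneq.Holds]
        refine Finset.sum_nonneg fun y _ => mul_nonneg ?_ (by cases eqAsg α β τ y <;> simp)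
        by_cases hy : y = z
        · subst hy; simp
        · simp [hy]
      | upper z =>
        simp only [LinIneq.Holds]
        rw [Finset.sum_eq_single z]
        · cases eqAsg α β τ z <;> simp
        · intro y _ hy
          simp [hy]
        · simp
      | add J K hJ hK => exact (ih1 J hJ β τ hsat).add (ih1 K hK β τ hsat)
      | mult J c hJ hc => exact (ih1 J hJ β τ hsat).mult hc
      | div J c a hJ hc ha => exact (ih1 J hJ β τ hsat).div hc ha
      | redPos J u hJ hu hl hpos =>
        have := ihu J hJ u hu hl false β τ
        simp only [LinIneq.Holds, sum_mul_update, sum_update_mul] at *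
        simp only [Bool.toInt_false] at this
        linarith
      | redNeg J u hJ hu hl hneg =>
        have := ihu J hJ u hu hl true β τ
        simp only [LinIneq.Holds, sum_mul_update, sum_update_mul] at *
        simp only [Bool.toInt_true] at this
        linarith
    have h2 : TFree I → ∀ β τ, I.Holds (eqAsg α β τ) := by
      intro hI β τ
      obtain ⟨τ', hτ'⟩ := equality_sat_of_ne (h I List.mem_cons_self hI)
      exact hI.holds (h1 _ τ' hτ') β τ
    exact ⟨List.forall_mem_cons.mpr ⟨h1, ih1⟩, List.forall_mem_cons.mpr ⟨h2, ih2⟩⟩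

theorem hard_of_two_pow_le {V : ℕ → Type} [∀ n, DecidableEq (V n)] [∀ n, Fintype (V n)]
    {S : SizedSystem} {F : (n : ℕ) → QBF (V n)} (h : ∀ n s, S (V n) (F n) s → 2 ^ n ≤ s) :
    Hard S F := by
  refine ⟨1, one_pos, Filter.Eventually.of_forall fun n s hs => ?_⟩
  rw [one_mul, Real.rpow_natCast]
  exact_mod_cast h n s hs

theorem two_pow_le_length {L : Type} (π : List L) (f : L → (Fin n → Bool) → Prop)
    (hf : ∀ l α β, f l α → f l β → α = β) (h : ∀ α, ∃ l ∈ π, f l α) : 2 ^ n ≤ π.length := by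
  classical
  choose g hg hgf using h
  have hinj : Function.Injective g := fun α β hαβ =>
    hf (g α) α β (hgf α) (hαβ ▸ hgf β)
  calc 2 ^ n = (Finset.univ.image g).card := by
        rw [Finset.card_image_of_injective _ hinj]; simp
    _ ≤ π.toFinset.card := Finset.card_le_card fun l hl => by
        obtain ⟨α, _, rfl⟩ := Finset.mem_image.mp hl
        exact List.mem_toFinset.mpr (hg α)
    _ ≤ π.length := List.toFinset_card_le π

theorem hard_CPRed_Equality : Hard CPRed Equality := by
  refine hard_of_two_pow_le ?_
  rintro n _ ⟨π, ⟨hπ, hhead⟩, rfl⟩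
  refine two_pow_le_length π (fun I α => response I = α) (fun _ _ _ h h' => h.symm.trans h') ?_
  intro α
  by_contra! hne
  have hmem : (⟨0, 1⟩ : LinIneq (EqualityVar n)) ∈ π := List.mem_of_mem_head? hhead
  have := (exists_response_eq hπ α fun I hI _ => hne I hI).2 _ hmem (fun i => rfl) α α
  simp [LinIneq.Holds] at this

theorem length_le_sum_length {V : Type} [Fintype V] (π : List (LinIneq V)) :
    π.length ≤ (π.map LinIneq.length).sum := by
  rw [← List.length_map (f := LinIneq.length)]
  refine List.length_le_sum_of_one_le _ fun k hk => ?_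
  obtain ⟨I, _, rfl⟩ := List.mem_map.mp hk
  simp only [LinIneq.length]
  omega

theorem hard_CPRedBits_Equality : Hard CPRedBits Equality := by
  refine hard_CPRed_Equality.of_simulates ⟨Polynomial.X, fun V _ _ Φ s => ?_⟩
  rintro ⟨π, hπ, rfl⟩
  exact ⟨π.length, by simpa using length_le_sum_length π, π, hπ, rfl⟩

end EqualityHard

/-! ### CP+∀Red simulates QU-Resolution. -/

section Simulation

variable {V : Type} [DecidableEq V]

/-- The inequality mentions only variables in `P` and has coefficients and right-hand side of
bounded absolute value. -/
def LinIneq.Bounded (P : Finset V) (a r : ℕ) (I : LinIneq V) : Prop :=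
  (∀ z, I.coeff z ≠ 0 → z ∈ P) ∧ (∀ z, |I.coeff z| ≤ a) ∧ |I.rhs| ≤ r

/-- Bounding the binary size of a number by the number itself is enough: in the simulation the
coefficients are bounded by 3 and the right-hand sides are linear in the size of `P`. -/
theorem LinIneq.Bounded.length_le [Fintype V] {P : Finset V} {a r : ℕ} {I : LinIneq V}
    (h : I.Bounded P a r) : I.length ≤ 1 + r + P.card * (1 + a) := by
  have size_le : ∀ m : ℕ, Nat.size m ≤ m := fun m => Nat.size_le.mpr Nat.lt_two_pow_self
  obtain ⟨h1, h2, h3⟩ := h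
  have h3' := abs_le.mp h3
  have hr : Nat.size I.rhs.natAbs ≤ r := (size_le _).trans (by omega)
  have hs : ∑ z with I.coeff z ≠ 0, (1 + Nat.size (I.coeff z).natAbs) ≤
      ∑ z ∈ P, (1 + a) := by
    refine (Finset.sum_le_sum fun z _ => ?_).trans
      (Finset.sum_le_sum_of_subset fun z hz => h1 z (by simpa using hz))
    have := abs_le.mp (h2 z)
    have := size_le (I.coeff z).natAbs
    omega
  rw [Finset.sum_const, smul_eq_mul] at hs
  simp only [LinIneq.length]
  omega

/-- Literal axioms can be added to an inequality. -/
theorem exists_add_axioms (Φ : QBF V) {P : Finset V} {δ : V → ℤ} (hδ : ∀ z, |δ z| ≤ 1)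
    (S : Finset V) (hS : S ⊆ P) {π : List (LinIneq V)} (hπ : Derivation (CPRedStep Φ) π)
    {I : LinIneq V} (hI : I ∈ π) {r : ℕ} (hIb : I.Bounded P 2 r) :
    ∃ ρ, Derivation (CPRedStep Φ) (ρ ++ π) ∧ ρ.length ≤ 2 * S.card ∧
      (∀ J ∈ ρ, J.Bounded P 3 (r + 1 + S.card)) ∧
      (⟨fun z => I.coeff z + if z ∈ S then δ z else 0, I.rhs + ∑ z ∈ S, min (δ z) 0⟩ :
        LinIneq V) ∈ ρ ++ π := by
  induction S using Finset.induction_on with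
  | empty => exact ⟨[], hπ, by simp, by simp, by simpa using hI⟩
  | insert y S hy ih =>
    obtain ⟨ρ, hρ, hlen, hb, hmem⟩ := ih fun z hz => hS (Finset.mem_insert_of_mem hz)
    set K : LinIneq V := ⟨fun z => I.coeff z + if z ∈ S then δ z else 0,
      I.rhs + ∑ z ∈ S, min (δ z) 0⟩ with hK
    set K' : LinIneq V := ⟨fun z => I.coeff z + if z ∈ insert y S then δ z else 0,
      I.rhs + ∑ z ∈ insert y S, min (δ z) 0⟩ with hK'
    have hcard : (insert y S).card = S.card + 1 := Finset.card_insert_of_notMem hy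
    have hK'b : K'.Bounded P 3 (r + 1 + (insert y S).card) := by
      obtain ⟨h1, h2, h3⟩ := hIb
      refine ⟨fun z hz => ?_, fun z => ?_, ?_⟩
      · by_contra hzP
        have hzS : z ∉ insert y S := fun h => hzP (hS h)
        have hz0 : I.coeff z = 0 := by
          by_contra h
          exact hzP (h1 z h)
        exact hz (by simp only [hK', if_neg hzS, hz0, add_zero])
      · have := h2 z
        have := hδ z
        simp only [hK']
        split_ifs <;> simp only [abs_le] at * <;> push_cast at * <;> constructor <;> linarith
      · have hsum : |∑ z ∈ insert y S, min (δ z) 0| ≤ ((insert y S).card : ℤ) := by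
          refine (Finset.abs_sum_le_sum_abs _ _).trans ?_
          rw [Finset.cast_card]
          refine Finset.sum_le_sum fun z _ => ?_
          have := hδ z
          rw [abs_le] at *
          constructor
          · exact le_min this.1 (by norm_num)
          · exact (min_le_right _ _).trans (by norm_num)
        simp only [hK']
        refine (abs_add_le _ _).trans ?_
        push_cast
        linarith
    have hmono : ∀ J : LinIneq V, J.Bounded P 3 (r + 1 + S.card) → J.Bounded P 3 (r + 1 + (insert y S).card) :=
      fun J hJ => ⟨hJ.1, hJ.2.1, hJ.2.2.trans (by rw [hcard]; push_cast; linarith)⟩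
    by_cases h0 : δ y = 0
    · refine ⟨ρ, hρ, by omega, fun J hJ => hmono J (hb J hJ), ?_⟩
      convert hmem using 1
      simp only [hK, hK', LinIneq.mk.injEq]
      constructor
      · funext z
        by_cases hz : z = y
        · subst hz; simp [hy, h0]
        · simp [hz]
      · rw [Finset.sum_insert hy]
        simp [h0]
    · have hax : ∃ J : LinIneq V, (∀ π, CPRedStep Φ π J) ∧ J.Bounded P 3 (r + 1 + (insert y S).card)
          ∧ J = ⟨Pi.single y (δ y), min (δ y) 0⟩ := by
        have hyP : y ∈ P := hS (Finset.mem_insert_self _ _)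
        have hb : ∀ v b : ℤ, |v| ≤ 1 → |b| ≤ 1 →
            LinIneq.Bounded P 3 (r + 1 + (insert y S).card) ⟨Pi.single y v, b⟩ := by
          intro v b hv hb
          refine ⟨fun z hz => ?_, fun z => ?_, ?_⟩
          · by_cases h : z = y
            · exact h ▸ hyP
            · simp [h] at hz
          · by_cases h : z = y
            · subst h; simp; linarith
            · simp [h]
          · push_cast; linarith [Int.natCast_nonneg r, Int.natCast_nonneg (insert y S).card]
        have hδy := abs_le.mp (hδ y)
        obtain h | h : δ y = 1 ∨ δ y = -1 := by omega
        · exact ⟨_, fun π => .lower y, hb _ _ (by norm_num) (by norm_num), by simp [h]⟩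
        · exact ⟨_, fun π => .upper y, hb _ _ (by norm_num) (by norm_num), by simp [h]⟩
      obtain ⟨J, hJ, hJb, hJeq⟩ := hax
      have hstep : CPRedStep Φ (J :: (ρ ++ π)) K' := by
        have := CPRedStep.add (Φ := Φ) (π := J :: (ρ ++ π)) K J (List.mem_cons_of_mem _ hmem)
          List.mem_cons_self
        convert this using 1
        rw [hJeq, hK, hK', LinIneq.mk.injEq]
        constructor
        · funext z
          by_cases hz : z = y
          · subst hz; simp [hy]
          · simp [hz]
        · rw [Finset.sum_insert hy]
          ring
      refine ⟨K' :: J :: ρ, .cons (.cons hρ (hJ _)) hstep, ?_, ?_, List.mem_cons_self⟩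
      · simp only [List.length_cons]
        omega
      · simp only [List.forall_mem_cons]
        exact ⟨hK'b, hJb, fun J hJ => hmono J (hb J hJ)⟩

/-- All variables of the clause lie in `P`. -/
def VarsIn (P : Finset V) (C : Clause V) : Prop := ∀ l ∈ C, l.1 ∈ P

theorem coeff_ne_zero_mem {P : Finset V} {C : Clause V} (hC : VarsIn P C) {z : V}
    (hz : (clauseIneq C).coeff z ≠ 0) : z ∈ P := by
  by_contra h
  have h1 : (z, true) ∉ C := fun h' => h (hC _ h')
  have h2 : (z, false) ∉ C := fun h' => h (hC _ h')
  simp [clauseIneq, h1, h2] at hz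

theorem card_filter_neg_le {P : Finset V} {C : Clause V} (hC : VarsIn P C) :
    (C.filter fun l => l.2 = false).card ≤ P.card := by
  refine Finset.card_le_card_of_injOn Prod.fst (fun l hl => hC l (Finset.filter_subset _ _ hl)) ?_
  rintro ⟨z, b⟩ h ⟨z', b'⟩ h' heq
  simp only [Finset.coe_filter, Set.mem_ofPred_eq] at h h' heq
  rw [heq, h.2, h'.2]

theorem abs_coeff_clauseIneq_le (C : Clause V) (z : V) : |(clauseIneq C).coeff z| ≤ 1 := by
  simp only [clauseIneq]
  split_ifs <;> simp

theorem bounded_clauseIneq {P : Finset V} {C : Clause V} (hC : VarsIn P C) :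
    (clauseIneq C).Bounded P 1 (1 + P.card) := by
  refine ⟨fun z hz => coeff_ne_zero_mem hC hz, abs_coeff_clauseIneq_le C, ?_⟩
  have := card_filter_neg_le hC
  simp only [clauseIneq]
  rw [abs_le]
  constructor <;> push_cast <;> omega

theorem LinIneq.Bounded.mono {P : Finset V} {a a' r r' : ℕ} {I : LinIneq V} (h : I.Bounded P a r)
    (ha : a ≤ a') (hr : r ≤ r') : I.Bounded P a' r' :=
  ⟨h.1, fun z => (h.2.1 z).trans (by exact_mod_cast ha), h.2.2.trans (by exact_mod_cast hr)⟩

variable [Fintype V]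

/-- The contribution of one non-pivot variable: `p, q` say that it occurs positively or negatively
in one premise, `p', q'` in the other, `r, s` in the resolvent. Twice the resolvent exceeds the sum
of the premises by at most one Boolean axiom. -/
theorem literal_arith {p q p' q' r s : Prop} [Decidable p] [Decidable q] [Decidable p']
    [Decidable q'] [Decidable r] [Decidable s] (h : p → ¬ q) (h' : p' → ¬ q')
    (hr : r ↔ p ∨ p') (hs : s ↔ q ∨ q') (hrs : r → ¬ s) :
    |2 * (((if r then 1 else 0) : ℤ) - if s then 1 else 0) -
      (((if p then 1 else 0) - if q then 1 else 0) +
        ((if p' then 1 else 0) - if q' then 1 else 0))| ≤ 1 ∧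
    min (2 * (((if r then 1 else 0) : ℤ) - if s then 1 else 0) -
      (((if p then 1 else 0) - if q then 1 else 0) +
        ((if p' then 1 else 0) - if q' then 1 else 0))) 0 =
      (if q then 1 else 0) + (if q' then 1 else 0) - 2 * if s then 1 else 0 := by
  by_cases p <;> by_cases q <;> by_cases p' <;> by_cases q' <;> simp_all

theorem exists_resolvent (Φ : QBF V) {P : Finset V} {C D : Clause V} {z : V} (hz : z ∈ P)
    (hC : VarsIn P C) (hD : VarsIn P D) (hCt : ¬ Taut C) (hDt : ¬ Taut D)
    (hzC : (z, true) ∈ C) (hzD : (z, false) ∈ D) (hR : ¬ Taut (resolvent C D z))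
    {π : List (LinIneq V)} (hπ : Derivation (CPRedStep Φ) π)
    (hCπ : clauseIneq C ∈ π) (hDπ : clauseIneq D ∈ π) :
    ∃ ρ, Derivation (CPRedStep Φ) (ρ ++ π) ∧ ρ.length ≤ 2 * P.card + 2 ∧
      (∀ J ∈ ρ, J.Bounded P 3 (3 + 3 * P.card)) ∧ clauseIneq (resolvent C D z) ∈ ρ ++ π := by
  set R := resolvent C D z with hRdef
  have hCt' : ∀ y, (y, true) ∈ C → (y, false) ∉ C := fun y h h' => hCt ⟨y, h, h'⟩
  have hDt' : ∀ y, (y, true) ∈ D → (y, false) ∉ D := fun y h h' => hDt ⟨y, h, h'⟩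
  have hRt' : ∀ y, (y, true) ∈ R → (y, false) ∉ R := fun y h h' => hR ⟨y, h, h'⟩
  have hmem : ∀ y, y ≠ z → ∀ b, ((y, b) ∈ R ↔ (y, b) ∈ C ∨ (y, b) ∈ D) := by
    intro y hy b
    simp [hRdef, resolvent, hy]
  have hzR : ∀ b, (z, b) ∉ R := by
    intro b
    have h1 := hCt' z hzC
    have h2 : (z, true) ∉ D := fun h => hDt' z h hzD
    cases b <;> simp [hRdef, resolvent, h1, h2]
  have hRP : VarsIn P R := by
    intro l hl
    rcases Finset.mem_union.mp hl with h | h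
    · exact hC l (Finset.mem_of_mem_erase h)
    · exact hD l (Finset.mem_of_mem_erase h)
  set S : LinIneq V := ⟨(clauseIneq C).coeff + (clauseIneq D).coeff,
    (clauseIneq C).rhs + (clauseIneq D).rhs⟩ with hS
  -- The missing literals: `δ y` is nonzero when `y` occurs in exactly one premise, and it vanishes
  -- at the pivot, whose two literals cancel in the sum.
  set δ : V → ℤ := fun y => 2 * (clauseIneq R).coeff y - S.coeff y with hδdef
  have hδz : δ z = 0 := by
    have h2 : (z, true) ∉ D := fun h => hDt' z h hzD
    simp [hδdef, hS, clauseIneq, hzC, hzD, hzR, hCt' z hzC, h2]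
  have hδ : ∀ y, |δ y| ≤ 1 := by
    intro y
    by_cases hy : y = z
    · rw [hy, hδz]; norm_num
    · have a1 := hCt' y
      have a2 := hDt' y
      exact (literal_arith (hCt' y) (hDt' y) (hmem y hy true) (hmem y hy false) (hRt' y)).1
  have hSb : S.Bounded P 2 (2 + 2 * P.card) := by
    obtain ⟨b1, b2, b3⟩ := bounded_clauseIneq hC
    obtain ⟨c1, c2, c3⟩ := bounded_clauseIneq hD
    refine ⟨fun y hy => ?_, fun y => (abs_add_le _ _).trans ?_, (abs_add_le _ _).trans ?_⟩
    · by_contra h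
      have h1 : (clauseIneq C).coeff y = 0 := by
        by_contra h'
        exact h (b1 y h')
      have h2 : (clauseIneq D).coeff y = 0 := by
        by_contra h'
        exact h (c1 y h')
      simp [hS, h1, h2] at hy
    · have := b2 y
      have := c2 y
      push_cast at *
      linarith
    · push_cast at *
      linarith
  obtain ⟨ρ, hρ, hlen, hb, hmemρ⟩ := exists_add_axioms Φ hδ P subset_rfl
    (hπ.cons (.add _ _ hCπ hDπ)) List.mem_cons_self hSb
  have hcoeff : (fun y => S.coeff y + if y ∈ P then δ y else 0) =
      (2 : ℤ) • (clauseIneq R).coeff := by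
    funext y
    by_cases hy : y ∈ P
    · simp [hy, hδdef]
    · have h1 : S.coeff y = 0 := by
        by_contra h
        exact hy (hSb.1 y h)
      have h2 : (clauseIneq R).coeff y = 0 := by
        by_contra h
        exact hy (coeff_ne_zero_mem hRP h)
      simp [hy, h1, h2]
  -- The cancelled pivot leaves the right-hand side short of twice the target by one, and division
  -- by 2 with rounding recovers exactly this loss.
  have hrhs : S.rhs + ∑ y ∈ P, min (δ y) 0 = 2 * (clauseIneq R).rhs - 1 := by
    have h0 : ∑ y ∈ P, min (δ y) 0 = ∑ y, min (δ y) 0 := by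
      refine Finset.sum_subset (Finset.subset_univ _) fun y _ hy => ?_
      have := congrFun hcoeff y
      have h1 : S.coeff y = 0 := by
        by_contra h
        exact hy (hSb.1 y h)
      simp only [hy, if_false, Pi.smul_apply, smul_eq_mul, h1] at this
      simp only [hδdef, h1]
      rw [← this]
      simp
    have hone : (1 : ℤ) = ∑ y, if y = z then 1 else 0 := by simp
    have hsum : ∑ y, min (δ y) 0 = ∑ y, ((if (y, false) ∈ C then (1 : ℤ) else 0) +
        (if (y, false) ∈ D then 1 else 0) - 2 * (if (y, false) ∈ R then 1 else 0) -
          if y = z then 1 else 0) := by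
      refine Finset.sum_congr rfl fun y _ => ?_
      by_cases hy : y = z
      · subst hy
        simp [hδz, hzR, hCt' y hzC, hzD]
      · have a1 := hCt' y
        have a2 := hDt' y
        simpa [hδdef, hS, clauseIneq, hy] using
          (literal_arith (hCt' y) (hDt' y) (hmem y hy true) (hmem y hy false) (hRt' y)).2
    rw [h0, hsum]
    simp only [Finset.sum_sub_distrib, Finset.sum_add_distrib, ← Finset.mul_sum, ← hone]
    simp only [hS, clauseIneq, card_filter_neg]
    ring
  have hstep : CPRedStep Φ (ρ ++ S :: π) (clauseIneq R) := by
    have := CPRedStep.div (Φ := Φ) (π := ρ ++ S :: π) _ 2 (clauseIneq R).coeff hmemρ (by norm_num)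
      hcoeff
    convert this using 1
    ext1
    · rfl
    · change _ = ⌈((S.rhs + ∑ y ∈ P, min (δ y) 0 : ℤ) : ℚ) / ((2 : ℤ) : ℚ)⌉
      rw [hrhs]
      symm
      rw [Int.ceil_eq_iff]
      push_cast
      constructor <;> linarith
  refine ⟨clauseIneq R :: (ρ ++ [S]), ?_, ?_, ?_, List.mem_cons_self⟩
  · simpa using hρ.cons hstep
  · simp only [List.length_cons, List.length_append, List.length_nil]
    omega
  · simp only [List.forall_mem_cons, List.forall_mem_append]
    refine ⟨(bounded_clauseIneq hRP).mono (by norm_num) (by omega), fun J hJ => ?_, ?_, by simp⟩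
    · exact (hb J hJ).mono le_rfl (by omega)
    · exact hSb.mono (by norm_num) (by omega)

theorem clauseIneq_erase_pos {C : Clause V} (hC : ¬ Taut C) {u : V} (hu : (u, true) ∈ C) :
    clauseIneq (C.erase (u, true)) =
      ⟨Function.update (clauseIneq C).coeff u 0, (clauseIneq C).rhs⟩ := by
  have h : (u, false) ∉ C := fun h => hC ⟨u, hu, h⟩
  ext1
  · funext y
    by_cases hy : y = u
    · subst hy; simp [clauseIneq, h]
    · simp [clauseIneq, hy]
  · simp only [clauseIneq]
    congr 3
    rw [Finset.filter_erase, Finset.erase_eq_of_notMem (by simp)]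

theorem clauseIneq_erase_neg {C : Clause V} (hC : ¬ Taut C) {u : V} (hu : (u, false) ∈ C) :
    clauseIneq (C.erase (u, false)) = ⟨Function.update (clauseIneq C).coeff u 0,
      (clauseIneq C).rhs - (clauseIneq C).coeff u⟩ := by
  have h : (u, true) ∉ C := fun h => hC ⟨u, h, hu⟩
  ext1
  · funext y
    by_cases hy : y = u
    · subst hy; simp [clauseIneq, h]
    · simp [clauseIneq, hy]
  · simp only [clauseIneq]
    have hmem : (u, false) ∈ C.filter fun l => l.2 = false := by simp [hu]
    rw [Finset.filter_erase, Finset.card_erase_of_mem hmem,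
      Nat.cast_sub (Finset.card_pos.mpr ⟨_, hmem⟩)]
    simp only [h, hu, if_true, if_false]
    push_cast
    ring

/-- Clauses may have far more variables than the refutation has lines, which would spoil the bit
size. Only clauses over the set `P` of eliminated variables are therefore translated. This suffices:
the premises of a step use only variables of the conclusion and the eliminated one, and the empty
clause has none. Quantifying over all larger `P` lets the set grow during the induction. -/
theorem exists_cpRed_derivation {Φ : QBF V} {π : List (Clause V)}
    (hπ : Derivation (QUResStep Φ) π) :
    (∀ C ∈ π, ¬ Taut C) ∧ ∃ P₀ : Finset V, P₀.card ≤ π.length ∧ ∀ P, P₀ ⊆ P →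
      ∃ ρ, Derivation (CPRedStep Φ) ρ ∧ ρ.length ≤ π.length * (2 * P.card + 2) ∧
        (∀ J ∈ ρ, J.Bounded P 3 (3 + 3 * P.card)) ∧
        ∀ C ∈ π, VarsIn P C → clauseIneq C ∈ ρ := by
  induction hπ with
  | nil => exact ⟨by simp, ∅, by simp, fun P _ => ⟨[], .nil, by simp, by simp, by simp⟩⟩
  | @cons π C hπ hs ih =>
    obtain ⟨hnt, P₀, hP₀, ih⟩ := ih
    -- The optional variable is the pivot or the reduced variable of the step; axioms eliminate
    -- none. Hence the set gains at most one element per line.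
    suffices h : ¬ Taut C ∧ ∃ z? : Option V, ∀ P, P₀ ⊆ P → (∀ z ∈ z?, z ∈ P) → VarsIn P C →
        ∀ ρ, Derivation (CPRedStep Φ) ρ → (∀ C ∈ π, VarsIn P C → clauseIneq C ∈ ρ) →
        ∃ ρ', Derivation (CPRedStep Φ) (ρ' ++ ρ) ∧ ρ'.length ≤ 2 * P.card + 2 ∧
          (∀ J ∈ ρ', J.Bounded P 3 (3 + 3 * P.card)) ∧ clauseIneq C ∈ ρ' ++ ρ by
      obtain ⟨hC, z?, h⟩ := h
      refine ⟨List.forall_mem_cons.mpr ⟨hC, hnt⟩, P₀ ∪ z?.toFinset, ?_, fun P hP => ?_⟩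
      · refine (Finset.card_union_le _ _).trans ?_
        rw [List.length_cons]
        have : z?.toFinset.card ≤ 1 := by cases z? <;> simp
        omega
      · obtain ⟨ρ, hρ, hlen, hb, hmem⟩ := ih P (Finset.union_subset_left hP)
        by_cases hCP : VarsIn P C
        · obtain ⟨ρ', hρ', hlen', hb', hmem'⟩ := h P (Finset.union_subset_left hP)
            (fun z hz => Finset.union_subset_right hP (by simpa using hz)) hCP ρ hρ hmem
          refine ⟨ρ' ++ ρ, hρ', ?_, List.forall_mem_append.mpr ⟨hb', hb⟩, ?_⟩
          · rw [List.length_append, List.length_cons, add_mul]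
            omega
          · exact List.forall_mem_cons.mpr ⟨fun _ => hmem', fun D hD hDP =>
              List.mem_append_right _ (hmem D hD hDP)⟩
        · refine ⟨ρ, hρ, hlen.trans (Nat.mul_le_mul_right _ (by simp)), hb, ?_⟩
          exact List.forall_mem_cons.mpr ⟨fun h => absurd h hCP, hmem⟩
    cases hs with
    | download A hA hAt =>
      refine ⟨hAt, none, fun P _ _ hCP ρ hρ _ => ⟨[clauseIneq C], hρ.cons (.download C hA), ?_, ?_,
        List.mem_cons_self⟩⟩
      · simp
      · simpa using (bounded_clauseIneq hCP).mono (by norm_num) (by omega)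
    | res A B z hA hB hzA hzB ht =>
      refine ⟨ht, some z, fun P _ hz hCP ρ hρ hmem => ?_⟩
      have hzP : z ∈ P := hz z rfl
      have hAP : VarsIn P A := by
        intro l hl
        by_cases h : l = (z, true)
        · exact h ▸ hzP
        · exact hCP l (Finset.mem_union_left _ (Finset.mem_erase.mpr ⟨h, hl⟩))
      have hBP : VarsIn P B := by
        intro l hl
        by_cases h : l = (z, false)
        · exact h ▸ hzP
        · exact hCP l (Finset.mem_union_right _ (Finset.mem_erase.mpr ⟨h, hl⟩))
      exact exists_resolvent Φ hzP hAP hBP (hnt A hA) (hnt B hB) hzA hzB ht hρ (hmem A hA hAP)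
        (hmem B hB hBP)
    | red A l hA hl hu hleft =>
      have hAt := hnt A hA
      refine ⟨fun ⟨y, h1, h2⟩ => hAt ⟨y, Finset.mem_of_mem_erase h1, Finset.mem_of_mem_erase h2⟩,
        some l.1, fun P _ hz hCP ρ hρ hmem => ?_⟩
      have hlP : l.1 ∈ P := hz _ rfl
      have hAP : VarsIn P A := by
        intro k hk
        by_cases h : k = l
        · exact h ▸ hlP
        · exact hCP k (Finset.mem_erase.mpr ⟨h, hk⟩)
      have hleft' : ∀ x, Φ.IsEx x → (clauseIneq A).coeff x ≠ 0 → Φ.LeftOf x l.1 := by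
        intro x hx hne
        by_cases h1 : (x, true) ∈ A
        · exact hleft _ h1 hx
        by_cases h2 : (x, false) ∈ A
        · exact hleft _ h2 hx
        simp [clauseIneq, h1, h2] at hne
      refine ⟨[clauseIneq (A.erase l)], hρ.cons ?_, by simp, ?_, List.mem_cons_self⟩
      · obtain ⟨u, b⟩ := l
        cases b with
        | true =>
          rw [clauseIneq_erase_pos hAt hl]
          refine .redPos _ u (hmem A hA hAP) hu hleft' ?_
          have h : (u, false) ∉ A := fun h => hAt ⟨u, hl, h⟩
          simp [clauseIneq, hl, h]
        | false =>
          rw [clauseIneq_erase_neg hAt hl]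
          refine .redNeg _ u (hmem A hA hAP) hu hleft' ?_
          have h : (u, true) ∉ A := fun h => hAt ⟨u, h, hl⟩
          simp [clauseIneq, hl, h]
      · simpa using (bounded_clauseIneq hCP).mono (by norm_num) (by omega)

end Simulation

theorem clauseIneq_empty {V : Type} [DecidableEq V] : clauseIneq (∅ : Clause V) = ⟨0, 1⟩ := by
  ext1
  · funext z
    simp [clauseIneq]
  · simp [clauseIneq]

theorem simulates_CPRedBits_QURes : Simulates CPRedBits QURes := by
  refine ⟨(Polynomial.X * (2 * Polynomial.X + 2) + 1) * (4 + 7 * Polynomial.X),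
    fun V _ _ Φ s => ?_⟩
  rintro ⟨π, hπ, hs⟩
  obtain ⟨-, P, hP, h⟩ := exists_cpRed_derivation hπ
  obtain ⟨ρ, hρ, hlen, hb, hmem⟩ := h P subset_rfl
  have hempty := hmem ∅ List.mem_cons_self (by simp [VarsIn])
  rw [clauseIneq_empty] at hempty
  -- Multiplication by 1 repeats `0 ≥ 1`, which may occur anywhere in `ρ`, as the final line.
  have hlast : CPRedStep Φ ρ ⟨0, 1⟩ := by
    simpa using CPRedStep.mult (Φ := Φ) _ 1 hempty one_pos
  refine ⟨_, ?_, ⟨0, 1⟩ :: ρ, ⟨hρ.cons hlast, rfl⟩, rfl⟩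
  rw [← hs] at hP hlen
  have hbound : ∀ k ∈ (((⟨0, 1⟩ : LinIneq V) :: ρ).map LinIneq.length), k ≤ 4 + 7 * P.card := by
    intro k hk
    obtain ⟨J, hJ, rfl⟩ := List.mem_map.mp hk
    have hJb : J ∈ ρ := by
      rcases List.mem_cons.mp hJ with rfl | hJ
      · exact hempty
      · exact hJ
    refine (hb J hJb).length_le.trans ?_
    omega
  refine (List.sum_le_card_nsmul _ _ hbound).trans ?_
  simp only [List.length_map, List.length_cons, smul_eq_mul, Polynomial.eval_mul,
    Polynomial.eval_add, Polynomial.eval_X, Polynomial.eval_one, Polynomial.eval_ofNat]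
  have : s * (2 * P.card + 2) ≤ s * (2 * s + 2) := by gcongr
  gcongr
  omega

theorem simulates_CPRed_QURes : Simulates CPRed QURes := by
  obtain ⟨p, hp⟩ := simulates_CPRedBits_QURes
  refine ⟨p, fun V _ _ Φ s hs => ?_⟩
  obtain ⟨t, ht, π, hπ, rfl⟩ := hp V Φ s hs
  exact ⟨π.length, (length_le_sum_length π).trans ht, π, hπ, rfl⟩

/-! ### Short QU-Resolution refutations of KBKF-lq. -/

theorem Derivation.exists_of_mem {L : Type} {step : List L → L → Prop} {π : List L}
    (hπ : Derivation step π) {l : L} (hl : l ∈ π) :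
    ∃ ρ, Derivation step (l :: ρ) ∧ (l :: ρ).length ≤ π.length := by
  induction hπ with
  | nil => simp at hl
  | @cons π k hπ hs ih =>
    rcases List.mem_cons.mp hl with rfl | hl
    · exact ⟨π, .cons hπ hs, le_rfl⟩
    · obtain ⟨ρ, hρ, hlen⟩ := ih hl
      exact ⟨ρ, hρ, hlen.trans (by simp)⟩

section QURes

variable {V : Type} [DecidableEq V]

theorem Taut.mono {C D : Clause V} (h : C ⊆ D) (hC : Taut C) : Taut D :=
  let ⟨z, h1, h2⟩ := hC
  ⟨z, h h1, h h2⟩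

/-- Negative literals whose complements are available as unit clauses can be cut away. -/
theorem exists_cut_units {Φ : QBF V} {π : List (Clause V)} (hπ : Derivation (QUResStep Φ) π)
    {C : Clause V} (hC : C ∈ π) (hCt : ¬ Taut C) (T : Clause V)
    (hT : ∀ l ∈ T, l.2 = false ∧ ({(l.1, true)} : Clause V) ∈ π) :
    ∃ ρ, Derivation (QUResStep Φ) (ρ ++ π) ∧ ρ.length ≤ T.card ∧ C \ T ∈ ρ ++ π := by
  induction T using Finset.induction_on with
  | empty => exact ⟨[], hπ, by simp, by simpa using hC⟩
  | insert l T hl ih =>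
    obtain ⟨ρ, hρ, hlen, hmem⟩ := ih fun k hk => hT k (Finset.mem_insert_of_mem hk)
    rw [Finset.card_insert_of_notMem hl]
    by_cases hlC : l ∈ C \ T
    · obtain ⟨hl2, hunit⟩ := hT l (Finset.mem_insert_self _ _)
      obtain ⟨z, b⟩ := l
      simp only at hl2 hunit
      subst hl2
      have hres : resolvent {(z, true)} (C \ T) z = C \ insert (z, false) T := by
        simp [resolvent, Finset.sdiff_insert]
      have hstep : QUResStep Φ (ρ ++ π) (resolvent {(z, true)} (C \ T) z) :=
        .res _ _ z (List.mem_append_right _ hunit) hmem (by simp) hlC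
          (by rw [hres]; exact fun h => hCt (h.mono Finset.sdiff_subset))
      rw [hres] at hstep
      exact ⟨(C \ insert (z, false) T) :: ρ, hρ.cons hstep, by simpa using hlen, List.mem_cons_self⟩
    · refine ⟨ρ, hρ, by omega, ?_⟩
      rwa [Finset.sdiff_insert, Finset.erase_eq_of_notMem hlC]

end QURes

namespace KBKF

variable {n : ℕ}

theorem mem_negDE {k : ℕ} {l : Lit (KBKFVar n)} :
    l ∈ negDE n k ↔ (l.1.1 = .d ∨ l.1.1 = .e) ∧ l.2 = false ∧ (l.1.2 : ℕ) = k := by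
  obtain ⟨⟨K, j⟩, b⟩ := l
  simp only [negDE, Finset.mem_biUnion, Finset.mem_filter, Finset.mem_univ, true_and,
    Finset.mem_insert, Finset.mem_singleton, Prod.mk.injEq]
  constructor
  · rintro ⟨i, hi, ⟨⟨rfl, rfl⟩, rfl⟩ | ⟨⟨rfl, rfl⟩, rfl⟩⟩ <;> simp [hi]
  · rintro ⟨rfl | rfl, rfl, hj⟩ <;> exact ⟨j, hj, by simp⟩

theorem mem_negF {k : ℕ} {l : Lit (KBKFVar n)} :
    l ∈ negF n k ↔ l.1.1 = .f ∧ l.2 = false ∧ k ≤ l.1.2 := by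
  obtain ⟨⟨K, j⟩, b⟩ := l
  simp only [negF, Finset.mem_image, Finset.mem_filter, Finset.mem_univ, true_and, Prod.mk.injEq]
  constructor
  · rintro ⟨i, hi, ⟨rfl, rfl⟩, rfl⟩
    exact ⟨rfl, rfl, hi⟩
  · rintro ⟨rfl, rfl, hj⟩
    exact ⟨j, hj, ⟨rfl, rfl⟩, rfl⟩

/-- The kind of the existential variable that falsifies its clause when `x_i` has value `v`. -/
def kind (v : Bool) : KBKFKind := bif v then .e else .d

/-- The clauses `clauseAd i` (for `v = false`) and `clauseAe i` (for `v = true`). -/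
def clauseDE (v : Bool) (i : Fin n) : Clause (KBKFVar n) :=
  {((kind v, i), true), ((.x, i), !v)} ∪ negDE n (i + 1) ∪ negF n 0

theorem mem_clauseDE {v : Bool} {i : Fin n} {l : Lit (KBKFVar n)} :
    l ∈ clauseDE v i ↔ l = ((kind v, i), true) ∨ l = ((.x, i), !v) ∨
      ((l.1.1 = .d ∨ l.1.1 = .e) ∧ l.2 = false ∧ (l.1.2 : ℕ) = i + 1) ∨
      (l.1.1 = .f ∧ l.2 = false) := by
  simp [clauseDE, mem_negDE, mem_negF]

theorem mem_clauseB {b : Bool} {i : Fin n} {l : Lit (KBKFVar n)} :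
    l ∈ clauseB b i ↔ l = ((.x, i), b) ∨ l = ((.f, i), true) ∨
      (l.1.1 = .f ∧ l.2 = false ∧ i < l.1.2) := by
  simp only [clauseB, Finset.mem_union, Finset.mem_insert, Finset.mem_singleton, mem_negF, or_assoc,
    Fin.lt_def, Nat.succ_le_iff]

theorem mem_matrix {A : Clause (KBKFVar n)} :
    A ∈ (KBKFlq n).matrix ↔ A = clauseA n ∨ (∃ v i, A = clauseDE v i) ∨ ∃ b i, A = clauseB b i := by
  simp only [KBKFlq, Finset.mem_union, Finset.mem_singleton, Finset.mem_image, Finset.mem_univ,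
    true_and, Bool.exists_bool, clauseDE, kind, cond_true, cond_false, Bool.not_true,
    Bool.not_false, clauseAd, clauseAe]
  tauto

theorem not_taut_clauseDE (v : Bool) (i : Fin n) : ¬ Taut (clauseDE v i) := by
  rintro ⟨⟨K, j⟩, h1, h2⟩
  simp only [mem_clauseDE, Prod.mk.injEq] at h1 h2
  cases v <;> simp_all [kind] <;> grind

theorem not_taut_clauseB (b : Bool) (i : Fin n) : ¬ Taut (clauseB b i) := by
  rintro ⟨⟨K, j⟩, h1, h2⟩
  simp only [mem_clauseB, Prod.mk.injEq] at h1 h2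
  cases b <;> simp_all

theorem not_taut_clauseA (n : ℕ) : ¬ Taut (clauseA n) := by
  rintro ⟨⟨K, j⟩, h1, h2⟩
  simp [clauseA, mem_negDE, mem_negF] at h1

theorem card_clause_le (T : Clause (KBKFVar n)) : T.card ≤ 8 * n := by
  refine (Finset.card_le_univ _).trans ?_
  rw [Fintype.card_prod, Fintype.card_prod, Fintype.card_fin, Fintype.card_bool,
    show Fintype.card KBKFKind = 4 from rfl]
  omega

/-- The units are produced from the last index downwards: resolving the two clauses of `f_i` over
the universal pivot `x_i` leaves, besides `f_i`, only negations of later `f_j`, whose units are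
already available. -/
theorem exists_units_f (n m : ℕ) (hm : m ≤ n) : ∃ π, Derivation (QUResStep (KBKFlq n)) π ∧
    π.length ≤ m * (8 * n + 3) ∧ ∀ j : Fin n, n ≤ j + m → ({((.f, j), true)} : Clause _) ∈ π := by
  induction m with
  | zero => exact ⟨[], .nil, by simp, fun j hj => by omega⟩
  | succ m ih =>
    obtain ⟨π, hπ, hlen, hf⟩ := ih (by omega)
    let i : Fin n := ⟨n - (m + 1), by omega⟩
    have hi : (i : ℕ) + (m + 1) = n := by simp [i]; omega
    let C : Clause (KBKFVar n) := resolvent (clauseB true i) (clauseB false i) (.x, i)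
    have hC : ∀ l, l ∈ C ↔ l = ((.f, i), true) ∨ l ∈ negF n (i + 1) := by
      rintro ⟨⟨K, j⟩, b⟩
      simp only [C, resolvent, Finset.mem_union, Finset.mem_erase, mem_clauseB, mem_negF,
        Prod.mk.injEq, Fin.lt_def, Nat.succ_le_iff]
      grind
    have hCt : ¬ Taut C := by
      rintro ⟨⟨K, j⟩, h1, h2⟩
      rw [hC] at h1 h2
      simp [mem_negF] at h1 h2
      grind
    have hder : Derivation (QUResStep (KBKFlq n)) (C :: clauseB false i :: clauseB true i :: π) := by
      refine ((hπ.cons (.download _ (mem_matrix.mpr (.inr (.inr ⟨_, _, rfl⟩)))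
        (not_taut_clauseB _ _))).cons (.download _ (mem_matrix.mpr (.inr (.inr ⟨_, _, rfl⟩)))
        (not_taut_clauseB _ _))).cons (.res _ _ _ (by simp) (by simp) ?_ ?_ hCt) <;>
      simp [mem_clauseB]
    obtain ⟨ρ, hρ, hρlen, hmem⟩ := exists_cut_units hder List.mem_cons_self hCt (negF n (i + 1)) (by
      rintro ⟨⟨K, j⟩, b⟩ hl
      simp only [mem_negF] at hl
      obtain ⟨rfl, rfl, hj⟩ := hl
      exact ⟨rfl, by simp [hf j (by omega)]⟩)
    have hCsub : C \ negF n (i + 1) = {((.f, i), true)} := by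
      ext l
      simp only [Finset.mem_sdiff, hC, Finset.mem_singleton]
      constructor
      · tauto
      · rintro rfl
        simp [mem_negF]
    rw [hCsub] at hmem
    refine ⟨_, hρ, ?_, fun j hj => ?_⟩
    · have hcard : (negF n (i + 1)).card ≤ 8 * n := card_clause_le _
      simp only [List.length_append, List.length_cons, add_mul, one_mul]
      omega
    · by_cases hji : j = i
      · exact hji ▸ hmem
      · have : n ≤ j + m := by
          have : (j : ℕ) ≠ i := fun h => hji (Fin.ext h)
          omega
        simp [hf j this]

/-- Once all negative existential literals are cut away, the only existential variable left is `d_i`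
or `e_i`. It lies left of `x_i`, so the literal of `x_i` can be reduced. -/
theorem exists_unit_de {n : ℕ} (v : Bool) (i : Fin n) {π : List (Clause (KBKFVar n))}
    (hπ : Derivation (QUResStep (KBKFlq n)) π)
    (hf : ∀ j, ({((.f, j), true)} : Clause _) ∈ π)
    (hde : ∀ v (j : Fin n), i < j → ({((kind v, j), true)} : Clause _) ∈ π) :
    ∃ ρ, Derivation (QUResStep (KBKFlq n)) (ρ ++ π) ∧ ρ.length ≤ 8 * n + 2 ∧
      ({((kind v, i), true)} : Clause _) ∈ ρ ++ π := by
  let T := negDE n (i + 1) ∪ negF n 0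
  have hder := hπ.cons (.download (clauseDE v i) (mem_matrix.mpr (.inr (.inl ⟨_, _, rfl⟩)))
    (not_taut_clauseDE _ _))
  obtain ⟨ρ, hρ, hρlen, hmem⟩ := exists_cut_units hder List.mem_cons_self (not_taut_clauseDE _ _) T
    (by
      rintro ⟨⟨K, j⟩, b⟩ hl
      simp only [T, Finset.mem_union, mem_negF, mem_negDE] at hl
      rcases hl with ⟨hK, rfl, hj⟩ | ⟨rfl, rfl, -⟩
      · have hij : i < j := Fin.lt_def.mpr (by omega)
        rcases hK with rfl | rfl
        · exact ⟨rfl, List.mem_cons_of_mem _ (hde false j hij)⟩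
        · exact ⟨rfl, List.mem_cons_of_mem _ (hde true j hij)⟩
      · exact ⟨rfl, by simp [hf j]⟩)
  have hsub : ∀ l, l ∈ clauseDE v i \ T ↔ l = ((kind v, i), true) ∨ l = ((.x, i), !v) := by
    rintro ⟨⟨K, j⟩, b⟩
    simp only [T, Finset.mem_sdiff, Finset.mem_union, mem_clauseDE, mem_negF, mem_negDE,
      Prod.mk.injEq]
    cases v <;> simp only [kind, cond_true, cond_false] <;> grind
  have herase : (clauseDE v i \ T).erase ((.x, i), !v) = {((kind v, i), true)} := by
    ext l
    rw [Finset.mem_erase, hsub, Finset.mem_singleton]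
    constructor
    · tauto
    · rintro rfl
      cases v <;> simp [kind]
  have hstep : QUResStep (KBKFlq n) (ρ ++ clauseDE v i :: π) {((kind v, i), true)} := by
    rw [← herase]
    refine .red _ _ hmem ((hsub _).mpr (.inr rfl)) ?_ fun k hk hex => ?_
    · simp [QBF.IsUniv, KBKFlq, level]
    · rcases (hsub k).mp hk with rfl | rfl
      · cases v <;> simp [QBF.LeftOf, KBKFlq, level, kind]
      · simp [QBF.IsEx, KBKFlq, level, parity_simps] at hex
  have hcard : T.card ≤ 8 * n := card_clause_le _
  refine ⟨{((kind v, i), true)} :: (ρ ++ [clauseDE v i]), by simpa using hρ.cons hstep, ?_,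
    List.mem_cons_self⟩
  simp only [List.length_cons, List.length_append, List.length_nil]
  omega

theorem exists_units_de (n m : ℕ) (hm : m ≤ n) : ∃ π, Derivation (QUResStep (KBKFlq n)) π ∧
    π.length ≤ n * (8 * n + 3) + m * (2 * (8 * n + 2)) ∧
    (∀ j, ({((.f, j), true)} : Clause _) ∈ π) ∧
    ∀ v (j : Fin n), n ≤ j + m → ({((kind v, j), true)} : Clause _) ∈ π := by
  induction m with
  | zero =>
    obtain ⟨π, hπ, hlen, hf⟩ := exists_units_f n n le_rfl
    exact ⟨π, hπ, by omega, fun j => hf j (by omega), fun v j hj => by omega⟩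
  | succ m ih =>
    obtain ⟨π, hπ, hlen, hf, hde⟩ := ih (by omega)
    let i : Fin n := ⟨n - (m + 1), by omega⟩
    have hi : (i : ℕ) + (m + 1) = n := by simp [i]; omega
    have hde' : ∀ v (j : Fin n), i < j → ({((kind v, j), true)} : Clause _) ∈ π := fun v j hj =>
      hde v j (by rw [Fin.lt_def] at hj; omega)
    obtain ⟨ρ, hρ, hρlen, hρm⟩ := exists_unit_de false i hπ hf hde'
    obtain ⟨ρ', hρ', hρlen', hρm'⟩ := exists_unit_de true i hρ
      (fun j => List.mem_append_right _ (hf j)) (fun v j hj => List.mem_append_right _ (hde' v j hj))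
    refine ⟨_, hρ', ?_, fun j => by simp [hf j], fun v j hj => ?_⟩
    · simp only [List.length_append, add_mul, one_mul]
      omega
    · by_cases hji : j = i
      · subst hji
        cases v
        · exact List.mem_append_right _ hρm
        · exact hρm'
      · have : n ≤ j + m := by
          have : (j : ℕ) ≠ i := fun h => hji (Fin.ext h)
          omega
        simp [hde v j this]

end KBKF

theorem easy_QURes_KBKFlq : Easy QURes KBKFlq := by
  open Polynomial in
  refine ⟨X * (8 * X + 3) + X * (2 * (8 * X + 2)) + 1 + 8 * X, fun n => ?_⟩
  obtain ⟨π, hπ, hlen, hf, hde⟩ := KBKF.exists_units_de n n le_rfl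
  have hder := hπ.cons (.download (KBKF.clauseA n) (KBKF.mem_matrix.mpr (.inl rfl))
    (KBKF.not_taut_clauseA n))
  obtain ⟨ρ, hρ, hρlen, hmem⟩ := exists_cut_units hder List.mem_cons_self (KBKF.not_taut_clauseA n)
    (KBKF.clauseA n) (by
      rintro ⟨⟨K, j⟩, b⟩ hl
      simp only [KBKF.clauseA, Finset.mem_union, KBKF.mem_negF, KBKF.mem_negDE] at hl
      rcases hl with ⟨rfl | rfl, rfl, hj⟩ | ⟨rfl, rfl, -⟩
      · exact ⟨rfl, List.mem_cons_of_mem _ (hde false j (by omega))⟩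
      · exact ⟨rfl, List.mem_cons_of_mem _ (hde true j (by omega))⟩
      · exact ⟨rfl, by simp [hf j]⟩)
  rw [Finset.sdiff_self] at hmem
  obtain ⟨σ, hσ, hσlen⟩ := hρ.exists_of_mem hmem
  refine ⟨_, ?_, σ, hσ, rfl⟩
  have hcard : (KBKF.clauseA n).card ≤ 8 * n := KBKF.card_clause_le _
  simp only [List.length_append, List.length_cons] at hσlen ⊢
  simp only [Polynomial.eval_add, Polynomial.eval_mul, Polynomial.eval_X, Polynomial.eval_ofNat,
    Polynomial.eval_one]
  omega

/-! ### Short Merge Resolution refutations of Equality. -/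

section EqualityEasy

variable {n : ℕ}

/-- The clause `{x_i, u_i, t_i}` (`b = true`) or `{¬x_i, ¬u_i, t_i}` (`b = false`). -/
def eqClause (b : Bool) (i : Fin n) : Clause (EqualityVar n) :=
  {((.x, i), b), ((.u, i), b), ((.t, i), true)}

/-- The merge map computing `u_i = x_i`. -/
def copyMap (i : Fin n) : MergeMap (EqualityVar n) :=
  insert (2, Instr.branch (.x, i) 0 1) (MergeMap.simple 0 (some false) ∪
    MergeMap.simple 1 (some true))

/-- The line of the axiom `eqClause b i`. -/
def eqAxiomLine (b : Bool) (i : Fin n) : MLine (Equality n) :=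
  ⟨(Equality n).exPart (eqClause b i),
    fun u => MergeMap.simple (bif b then 0 else 1) (falsifyingValue (eqClause b i) u.1)⟩

/-- The line with clause `{t_i}`. -/
def unitLine (i : Fin n) : MLine (Equality n) :=
  ⟨{((.t, i), true)}, fun u => if u.1.2 = i then copyMap i else MergeMap.simple 0 none⟩

/-- The line with clause `{¬t_k, ..., ¬t_n}`. -/
def tailLine (n k : ℕ) : MLine (Equality n) :=
  ⟨(Finset.univ.filter fun i : Fin n => k ≤ i).image fun i => ((.t, i), false),
    fun u => if (u.1.2 : ℕ) < k then copyMap u.1.2 else MergeMap.simple 0 none⟩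

theorem fst_eq_u {u : EqualityVar n} (hu : (Equality n).IsUniv u) : u = (.u, u.2) := by
  obtain ⟨k, i⟩ := u
  cases k
  · simp [QBF.IsUniv, Equality] at hu
  · rfl
  · exact absurd hu (by simp [QBF.IsUniv, Equality])

theorem eqAxiomLine_step (b : Bool) (i : Fin n) (π : List (MLine (Equality n))) :
    MResStep (Equality n) π (eqAxiomLine b i) := by
  refine .download (eqClause b i) _ ?_ ?_
  · cases b <;> simp [Equality, eqClause]
  · rintro ⟨z, h1, h2⟩
    cases b <;> simp [eqClause] at h1 h2 <;> simp_all

theorem mem_eqAxiomLine (b : Bool) (i : Fin n) (l : Lit (EqualityVar n)) :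
    l ∈ (eqAxiomLine b i).clause ↔ l = ((.x, i), b) ∨ l = ((.t, i), true) := by
  simp only [eqAxiomLine, QBF.exPart, Finset.mem_filter, eqClause, Finset.mem_insert,
    Finset.mem_singleton]
  constructor
  · rintro ⟨rfl | rfl | rfl, h⟩
    · simp
    · simp [QBF.IsEx, Equality] at h
    · simp
  · rintro (rfl | rfl) <;> simp [QBF.IsEx, Equality]

theorem falsifyingValue_eqClause (b : Bool) (i j : Fin n) :
    falsifyingValue (eqClause b i) (.u, j) = if j = i then some (!b) else none := by
  by_cases h : j = i <;> cases b <;> simp [falsifyingValue, eqClause, h]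

/-- The two axioms number their instructions 0 and 1, so their maps for `u_i` are consistent and
merge under a new instruction 2. For every other `u_j` both maps are trivial. -/
theorem unitLine_step (i : Fin n) {π : List (MLine (Equality n))}
    (h₀ : eqAxiomLine true i ∈ π) (h₁ : eqAxiomLine false i ∈ π) :
    MResStep (Equality n) π (unitLine i) := by
  have hc : resolvent (eqAxiomLine true i).clause (eqAxiomLine false i).clause (.x, i) =
      {((.t, i), true)} := by
    ext l
    simp only [resolvent, Finset.mem_union, Finset.mem_erase, mem_eqAxiomLine,
      Finset.mem_singleton]
    constructor
    · tauto
    · rintro rfl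
      simp
  rw [unitLine, ← hc]
  refine .res _ _ _ _ h₀ h₁ (by simp [QBF.IsEx, Equality]) (by simp [mem_eqAxiomLine])
    (by simp [mem_eqAxiomLine]) fun ⟨u, hu⟩ => ?_
  obtain ⟨k, j⟩ := u
  obtain rfl : k = .u := congrArg Prod.fst (fst_eq_u hu)
  simp only [eqAxiomLine, falsifyingValue_eqClause]
  by_cases h : j = i
  · subst h
    refine .inr (.inr (.inr ⟨by simp [QBF.LeftOf, Equality], ?_, 2, ?_, ?_⟩))
    · simp [MergeMap.Consistent, MergeMap.simple]
    · simp [MergeMap.simple]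
    · simp [MergeMap.lead, MergeMap.simple, copyMap]
  · exact .inr (.inl ⟨⟨1, by simp [h]⟩, by simp [h]⟩)

/-- The pivot `t_k` is right of all universal variables, so nothing may be merged. Nothing has to
be: for every `u_j` one premise is trivial, the tail line if `j = k` and the unit line otherwise. -/
theorem tailLine_succ_step (k : Fin n) {π : List (MLine (Equality n))}
    (h₀ : unitLine k ∈ π) (h₁ : tailLine n k ∈ π) :
    MResStep (Equality n) π (tailLine n (k + 1)) := by
  have hc : resolvent (unitLine k).clause (tailLine n k).clause (.t, k) =
      (tailLine n (k + 1)).clause := by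
    ext ⟨⟨K, j⟩, b⟩
    simp only [resolvent, unitLine, tailLine, Finset.mem_union, Finset.mem_erase,
      Finset.mem_singleton, Finset.mem_image, Finset.mem_filter, Finset.mem_univ, true_and,
      Prod.mk.injEq]
    constructor
    · rintro (⟨h, ⟨rfl, rfl⟩, rfl⟩ | ⟨h1, i, h2, ⟨rfl, rfl⟩, rfl⟩)
      · exact absurd rfl h
      · refine ⟨i, ?_, ⟨rfl, rfl⟩, rfl⟩
        have : (i : ℕ) ≠ k := fun h => h1 (by simp [Fin.ext h])
        omega
    · rintro ⟨i, h2, ⟨rfl, rfl⟩, rfl⟩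
      refine .inr ⟨?_, i, by omega, ⟨rfl, rfl⟩, rfl⟩
      rintro ⟨⟨-, rfl⟩, -⟩
      omega
  have hL : tailLine n (k + 1) = ⟨resolvent (unitLine k).clause (tailLine n k).clause (.t, k),
    (tailLine n (k + 1)).map⟩ := by rw [hc]
  rw [hL]
  refine .res _ _ _ _ h₀ h₁ (by simp [QBF.IsEx, Equality]) (by simp [unitLine])
    (by simp [tailLine]) fun ⟨u, hu⟩ => ?_
  obtain ⟨K, j⟩ := u
  simp only [unitLine, tailLine]
  by_cases h : j = k
  · subst h
    exact .inr (.inl ⟨⟨0, by simp⟩, by simp⟩)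
  · have : (j : ℕ) ≠ k := fun h' => h (Fin.ext h')
    refine .inl ⟨⟨0, by simp [h]⟩, ?_⟩
    simp only [show (j : ℕ) < k + 1 ↔ (j : ℕ) < k by omega]

theorem tailLine_zero_step (n : ℕ) (π : List (MLine (Equality n))) :
    MResStep (Equality n) π (tailLine n 0) := by
  let A : Clause (EqualityVar n) := Finset.univ.image fun i : Fin n => ((.t, i), false)
  have h : tailLine n 0 =
      ⟨(Equality n).exPart A, fun u => MergeMap.simple 0 (falsifyingValue A u.1)⟩ := by
    simp only [tailLine, MLine.mk.injEq]
    constructor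
    · ext l
      simp only [A, QBF.exPart, Finset.mem_filter, Finset.mem_image, Finset.mem_univ, true_and,
        Nat.zero_le]
      constructor
      · rintro ⟨i, rfl⟩
        exact ⟨⟨i, rfl⟩, by simp [QBF.IsEx, Equality]⟩
      · exact fun h => h.1
    · funext ⟨u, hu⟩
      obtain ⟨k, j⟩ := u
      obtain rfl : k = .u := congrArg Prod.fst (fst_eq_u hu)
      simp [falsifyingValue, A]
  rw [h]
  refine .download A 0 ?_ ?_
  · simp [Equality, A]
  · rintro ⟨z, h1, h2⟩
    simp [A] at h1

theorem exists_tailLine (n k : ℕ) (hk : k ≤ n) : ∃ π, Derivation (MResStep (Equality n)) π ∧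
    π.length = 4 * k + 1 ∧ tailLine n k ∈ π := by
  induction k with
  | zero => exact ⟨[tailLine n 0], .cons .nil (tailLine_zero_step n _), by simp, by simp⟩
  | succ k ih =>
    obtain ⟨π, hπ, hlen, hmem⟩ := ih (by omega)
    let i : Fin n := ⟨k, by omega⟩
    refine ⟨tailLine n (k + 1) :: unitLine i :: eqAxiomLine true i :: eqAxiomLine false i :: π,
      (((hπ.cons (eqAxiomLine_step _ _ _)).cons (eqAxiomLine_step _ _ _)).cons
        (unitLine_step i (by simp) (by simp))).cons
          (tailLine_succ_step i (by simp) (by simp [i, hmem])), ?_, by simp⟩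
    simp only [List.length_cons]
    omega

theorem easy_MRes_Equality : Easy MRes Equality := by
  refine ⟨4 * Polynomial.X + 1, fun n => ?_⟩
  obtain ⟨π, hπ, hlen, hmem⟩ := exists_tailLine n n le_rfl
  obtain ⟨ρ, hρ, hρlen⟩ := hπ.exists_of_mem hmem
  refine ⟨_, ?_, ρ, tailLine n n, hρ, ?_, rfl⟩
  · simpa [hlen] using hρlen
  · ext l
    simp only [tailLine, Finset.mem_image, Finset.mem_filter, Finset.mem_univ, true_and,
      Finset.notMem_empty, iff_false]
    rintro ⟨i, hi, -⟩
    omega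

end EqualityEasy

/-! ### Constant merge maps under resolution. -/

section MergeMaps

variable {V : Type} [DecidableEq V]

/-- The merge map is the single instruction "output `b`". -/
def MergeMap.IsConst (M : MergeMap V) (b : Option Bool) : Prop := ∃ i, M = MergeMap.simple i b

theorem MergeMap.IsConst.unique {M : MergeMap V} {b b' : Option Bool} (h : M.IsConst b)
    (h' : M.IsConst b') : b = b' := by
  obtain ⟨i, rfl⟩ := h
  obtain ⟨j, h⟩ := h'
  simp only [MergeMap.simple, Finset.singleton_inj, Prod.mk.injEq, Instr.out.injEq] at h
  exact h.2

theorem MergeMap.Iso.isConst {M₀ M₁ : MergeMap V} (h : M₀.Iso M₁) {b : Option Bool}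
    (h₀ : M₀.IsConst b) : M₁.IsConst b := by
  obtain ⟨σ, rfl⟩ := h
  obtain ⟨i, rfl⟩ := h₀
  exact ⟨σ i, by simp [MergeMap.simple, Instr.rename]⟩

theorem MergeMap.IsMerge.not_isConst {x : V} {M₀ M₁ M : MergeMap V} (h : IsMerge x M₀ M₁ M)
    (b : Option Bool) : ¬ M.IsConst b := by
  rintro ⟨i, rfl⟩
  obtain ⟨-, l, -, h⟩ := h
  have := Finset.mem_insert_self (l, Instr.branch x (lead M₀) (lead M₁)) (M₀ ∪ M₁)
  rw [← h] at this
  simp [MergeMap.simple] at this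

/-- The relation between the merge maps of `u` in a resolution step over `x`. -/
def Combines (Φ : QBF V) (x u : V) (M₀ M₁ M : MergeMap V) : Prop :=
  (M₀.Trivial ∧ M = M₁) ∨ (M₁.Trivial ∧ M = M₀) ∨ (M = M₀ ∧ M₀.Iso M₁) ∨
    (Φ.LeftOf x u ∧ MergeMap.IsMerge x M₀ M₁ M)

namespace Combines

variable {Φ : QBF V} {x u : V} {M₀ M₁ M : MergeMap V} {b : Option Bool}

/-- A merge contains a branching instruction, so a constant result arises by copying. In particular,
with `b = none`, a trivial result has trivial premises. -/
theorem left (h : Combines Φ x u M₀ M₁ M) (hM : M.IsConst b) :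
    M₀.IsConst none ∨ M₀.IsConst b := by
  rcases h with ⟨h, rfl⟩ | ⟨h, rfl⟩ | ⟨rfl, h⟩ | ⟨-, h⟩
  · exact .inl h
  · exact .inr hM
  · exact .inr hM
  · exact absurd hM (h.not_isConst b)

theorem right (h : Combines Φ x u M₀ M₁ M) (hM : M.IsConst b) :
    M₁.IsConst none ∨ M₁.IsConst b := by
  rcases h with ⟨h, rfl⟩ | ⟨h, rfl⟩ | ⟨rfl, h⟩ | ⟨-, h⟩
  · exact .inr hM
  · exact .inl h
  · exact .inr (h.isConst hM)
  · exact absurd hM (h.not_isConst b)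

theorem trivial_or (h : Combines Φ x u M₀ M₁ M) (hx : ¬ Φ.LeftOf x u) (h₀ : M₀.IsConst b) :
    M₀.IsConst none ∨ M.IsConst b := by
  rcases h with ⟨h, rfl⟩ | ⟨h, rfl⟩ | ⟨rfl, h⟩ | ⟨h, -⟩
  · exact .inl h
  · exact .inr h₀
  · exact .inr h₀
  · exact absurd h hx

theorem exists_isConst (h : Combines Φ x u M₀ M₁ M) (hx : ¬ Φ.LeftOf x u)
    (h₀ : ∃ b, M₀.IsConst b) (h₁ : ∃ b, M₁.IsConst b) : ∃ b, M.IsConst b := by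
  rcases h with ⟨h, rfl⟩ | ⟨h, rfl⟩ | ⟨rfl, h⟩ | ⟨h, -⟩
  · exact h₁
  · exact h₀
  · exact h₀
  · exact absurd h hx

end Combines

/-- The assignment `σ` falsifies the clause `C`. -/
def Fals (σ : V → Bool) (C : Clause V) : Prop := ∀ l ∈ C, σ l.1 ≠ l.2

theorem Fals.of_erase {σ : V → Bool} {C : Clause V} {l : Lit V} (h : Fals σ (C.erase l))
    (hl : σ l.1 ≠ l.2) : Fals σ C := by
  intro k hk
  by_cases hkl : k = l
  · exact hkl ▸ hl
  · exact h k (Finset.mem_erase.mpr ⟨hkl, hk⟩)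

theorem Fals.left {σ : V → Bool} {C D : Clause V} {z : V} (h : Fals σ (resolvent C D z))
    (hz : σ z = false) : Fals σ C :=
  Fals.of_erase (l := (z, true)) (fun k hk => h k (Finset.mem_union_left _ hk)) (by simp [hz])

theorem Fals.right {σ : V → Bool} {C D : Clause V} {z : V} (h : Fals σ (resolvent C D z))
    (hz : σ z = true) : Fals σ D :=
  Fals.of_erase (l := (z, false)) (fun k hk => h k (Finset.mem_union_right _ hk)) (by simp [hz])

theorem mem_resolvent {C D : Clause V} {z : V} {l : Lit V} :
    l ∈ resolvent C D z ↔ (l ≠ (z, true) ∧ l ∈ C) ∨ (l ≠ (z, false) ∧ l ∈ D) := by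
  simp [resolvent]

end MergeMaps

/-! ### KBKF-lq is hard for Merge Resolution. -/

namespace KBKF

variable {n : ℕ}

/-- The merge map of the line for `x_k`. -/
def xmap (L : MLine (KBKFlq n)) (k : Fin n) : MergeMap (KBKFVar n) :=
  L.map ⟨(.x, k), by simp [QBF.IsUniv, KBKFlq, level]⟩

/-- The assignment with `d_i = α_i`, `e_i = ¬α_i` for `i < k` and value `1` elsewhere. -/
def asg (α : Fin n → Bool) (k : ℕ) : KBKFVar n → Bool
  | (.d, i) => if (i : ℕ) < k then α i else true
  | (.e, i) => if (i : ℕ) < k then !α i else true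
  | _ => true

theorem leftOf_x {K : KBKFKind} {j k : Fin n} (hK : K = .d ∨ K = .e) :
    (KBKFlq n).LeftOf (K, j) (.x, k) ↔ j ≤ k := by
  rcases hK with rfl | rfl <;> simp only [QBF.LeftOf, KBKFlq, level, Fin.le_def] <;> omega

theorem not_leftOf_x (j k : Fin n) : ¬ (KBKFlq n).LeftOf (.f, j) (.x, k) := by
  simp only [QBF.LeftOf, KBKFlq, level]
  omega

/-- The lines that contain some literal `f_j`. -/
def PosLine (L : MLine (KBKFlq n)) (j : Fin n) : Prop :=
  ((.f, j), true) ∈ L.clause ∧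
  (∀ l ∈ L.clause, l = ((.f, j), true) ∨ ∃ k, j < k ∧ l = ((.f, k), false)) ∧
  (∀ k, ∃ b, (xmap L k).IsConst b) ∧ ¬ (xmap L j).IsConst none ∧
  ∀ k, j < k → ((.f, k), false) ∈ L.clause ∨ ¬ (xmap L k).IsConst none

/-- The invariants of the lines without literals `f_j`. -/
structure NegLine (α : Fin n → Bool) (L : MLine (KBKFlq n)) : Prop where
  notMem_f : ∀ j, ((.f, j), true) ∉ L.clause
  pos_unique : ∀ l ∈ L.clause, ∀ l' ∈ L.clause, l.2 = true → l'.2 = true → l = l'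
  pos_lt_neg : ∀ l ∈ L.clause, ∀ l' ∈ L.clause, l.2 = true → l'.2 = false → l'.1.1 ≠ .f →
    l.1.2 < l'.1.2
  isConst_below : ∀ l ∈ L.clause, l.2 = true → ∀ k < l.1.2, ∃ b, (xmap L k).IsConst b
  mem_of_trivial : ∀ k, (xmap L k).IsConst none → ((.f, k), false) ∈ L.clause
  nontrivial_of_neg : ∀ l ∈ L.clause, l.2 = false → l.1.1 ≠ .f → ∀ k < l.1.2,
    (∀ l' ∈ L.clause, l'.2 = true → l'.1.2 ≤ k) → ¬ (xmap L k).IsConst none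
  nontrivial_of_fals : Fals (asg α n) L.clause → ∀ k,
    (∀ l' ∈ L.clause, l'.2 = true → l'.1.2 ≤ k) → ¬ (xmap L k).IsConst none
  eq_of_fals : ∀ k : Fin n, Fals (asg α (k + 1)) L.clause → ∀ b, (xmap L k).IsConst b →
    b = some (α k)

theorem falsifyingValue_clauseA (k : Fin n) : falsifyingValue (clauseA n) (.x, k) = none := by
  simp [falsifyingValue, clauseA, mem_negDE, mem_negF]

theorem falsifyingValue_clauseDE (v : Bool) (i k : Fin n) :
    falsifyingValue (clauseDE v i) (.x, k) = if k = i then some v else none := by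
  cases v <;> by_cases h : k = i <;> simp [falsifyingValue, mem_clauseDE, kind, h]

theorem falsifyingValue_clauseB (b : Bool) (i k : Fin n) :
    falsifyingValue (clauseB b i) (.x, k) = if k = i then some (!b) else none := by
  cases b <;> by_cases h : k = i <;> simp [falsifyingValue, mem_clauseB, h]

theorem isEx_iff {z : KBKFVar n} : (KBKFlq n).IsEx z ↔ z.1 ≠ .x := by
  obtain ⟨K, j⟩ := z
  cases K <;> simp [QBF.IsEx, KBKFlq, level, parity_simps]

theorem isConst_simple {M : MergeMap (KBKFVar n)} {i : ℕ} {a b : Option Bool}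
    (hM : M = MergeMap.simple i a) : M.IsConst b ↔ a = b :=
  ⟨fun h => MergeMap.IsConst.unique ⟨i, hM⟩ h, fun h => ⟨i, h ▸ hM⟩⟩

/-- Below `k` the assignment gives `d_j` and `e_j` opposite values, so it satisfies one of the two
negative literals. -/
theorem not_fals_asg {α : Fin n → Bool} {C : Clause (KBKFVar n)} {k : ℕ} {j : Fin n} (hj : j < k)
    (hd : ((.d, j), false) ∈ C) (he : ((.e, j), false) ∈ C) : ¬ Fals (asg α k) C := by
  intro h
  have h1 := h _ hd
  have h2 := h _ he
  simp [asg, hj] at h1 h2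
  simp [h1] at h2

theorem negLine_clauseA (α : Fin n → Bool) {L : MLine (KBKFlq n)}
    (hC : L.clause = (KBKFlq n).exPart (clauseA n)) : NegLine α L := by
  have hmem : ∀ l, l ∈ L.clause ↔ l.2 = false ∧
      (((l.1.1 = .d ∨ l.1.1 = .e) ∧ (l.1.2 : ℕ) = 0) ∨ l.1.1 = .f) := by
    rintro ⟨⟨K, j⟩, b⟩
    simp only [hC, QBF.exPart, Finset.mem_filter, isEx_iff, clauseA, Finset.mem_union, mem_negDE,
      mem_negF]
    grind
  have hfals : ∀ k, 0 < n → 0 < k → ¬ Fals (asg α k) L.clause := fun k hn hk =>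
    not_fals_asg (j := ⟨0, hn⟩) hk (by simp [hmem]) (by simp [hmem])
  refine ⟨by simp [hmem], ?_, ?_, ?_, by simp [hmem], ?_, ?_, ?_⟩
  · intro l hl _ _ h
    simp [hmem, h] at hl
  · intro l hl _ _ h
    simp [hmem, h] at hl
  · intro l hl h
    simp [hmem, h] at hl
  · intro l hl _ hf k hk
    rw [hmem] at hl
    rw [Fin.lt_def] at hk
    obtain ⟨-, ⟨-, h⟩ | h⟩ := hl
    · omega
    · exact absurd h hf
  · exact fun h k => absurd h (hfals n (k.pos) (k.pos))
  · exact fun k h => absurd h (hfals _ k.pos (Nat.succ_pos _))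

theorem negLine_clauseDE (α : Fin n → Bool) {L : MLine (KBKFlq n)} {v : Bool} {i : Fin n}
    (hC : L.clause = (KBKFlq n).exPart (clauseDE v i)) {a : ℕ}
    (hm : ∀ k, xmap L k = MergeMap.simple a (if k = i then some v else none)) : NegLine α L := by
  have hmem : ∀ l, l ∈ L.clause ↔ l = ((kind v, i), true) ∨ (l.2 = false ∧
      (((l.1.1 = .d ∨ l.1.1 = .e) ∧ (l.1.2 : ℕ) = i + 1) ∨ l.1.1 = .f)) := by
    rintro ⟨⟨K, j⟩, b⟩
    simp only [hC, QBF.exPart, Finset.mem_filter, isEx_iff, mem_clauseDE, Prod.mk.injEq]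
    cases v <;> simp only [kind, cond_true, cond_false] <;> grind
  have hpos : ((kind v, i), true) ∈ L.clause := (hmem _).mpr (.inl rfl)
  have hpos' : ∀ l ∈ L.clause, l.2 = true → l = ((kind v, i), true) := by
    intro l hl h
    rcases (hmem l).mp hl with h' | h'
    · exact h'
    · simp [h] at h'
  have hni : ¬ (xmap L i).IsConst none := by
    simp [isConst_simple (hm i)]
  -- If `k > i + 1`, then index `i + 1` exists because `k ≤ n`, and its negated pair is satisfied.
  have hle : ∀ k : ℕ, k ≤ n → Fals (asg α k) L.clause → k ≤ i + 1 := by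
    intro k hk h
    by_contra! hlt
    exact not_fals_asg (j := ⟨i + 1, by omega⟩) hlt (by simp [hmem]) (by simp [hmem]) h
  refine ⟨?_, ?_, ?_, ?_, ?_, ?_, ?_, ?_⟩
  · intro j hj
    have := hpos' _ hj rfl
    cases v <;> simp [kind] at this
  · intro l hl l' hl' h h'
    rw [hpos' l hl h, hpos' l' hl' h']
  · intro l hl l' hl' h h' hf
    rw [hpos' l hl h]
    rcases (hmem l').mp hl' with rfl | ⟨-, ⟨-, h2⟩ | h2⟩
    · simp at h'
    · rw [Fin.lt_def]
      simp only
      omega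
    · exact absurd h2 hf
  · exact fun _ _ _ k _ => ⟨_, a, hm k⟩
  · exact fun k _ => (hmem _).mpr (.inr ⟨rfl, .inr rfl⟩)
  · intro l hl h hf k hk hle
    have h1 : i ≤ k := hle _ hpos rfl
    rcases (hmem l).mp hl with rfl | ⟨-, ⟨-, h2⟩ | h2⟩
    · simp at h
    · have : k = i := by
        rw [Fin.lt_def] at hk
        exact le_antisymm (Fin.le_def.mpr (by omega)) h1
      exact this ▸ hni
    · exact absurd h2 hf
  · intro h k hk
    have h1 : i ≤ k := hk _ hpos rfl
    have := hle n le_rfl h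
    have : k = i := le_antisymm (Fin.le_def.mpr (by omega)) h1
    exact this ▸ hni
  · intro k h b hb
    have h1 := hle _ (Nat.succ_le_iff.mpr k.2) h
    have h2 := h _ hpos
    -- Beyond the truncation all variables have value 1, which would satisfy the positive literal.
    -- Together with `h1` this leaves only `k = i`.
    have h3 : (i : ℕ) < k + 1 := by
      by_contra h3
      cases v <;> simp [kind, asg, h3] at h2
    obtain rfl : k = i := Fin.ext (by omega)
    rw [isConst_simple (hm k), if_pos rfl] at hb
    have h4 : α k = v := by cases v <;> simpa [kind, asg] using h2
    rw [← hb, h4]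

theorem posLine_clauseB {L : MLine (KBKFlq n)} {b : Bool} {i : Fin n}
    (hC : L.clause = (KBKFlq n).exPart (clauseB b i)) {a : ℕ}
    (hm : ∀ k, xmap L k = MergeMap.simple a (if k = i then some (!b) else none)) :
    PosLine L i := by
  have hmem : ∀ l, l ∈ L.clause ↔ l = ((.f, i), true) ∨
      (l.1.1 = .f ∧ l.2 = false ∧ i < l.1.2) := by
    rintro ⟨⟨K, j⟩, c⟩
    simp only [hC, QBF.exPart, Finset.mem_filter, isEx_iff, mem_clauseB, Prod.mk.injEq]
    grind
  refine ⟨by simp [hmem], ?_, fun k => ⟨_, a, hm k⟩, ?_, ?_⟩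
  · rintro ⟨⟨K, j⟩, c⟩ hl
    rcases (hmem _).mp hl with h | ⟨rfl, rfl, h⟩
    · exact .inl h
    · exact .inr ⟨j, h, rfl⟩
  · simp [isConst_simple (hm i)]
  · exact fun k hk => .inl ((hmem _).mpr (.inr ⟨rfl, rfl, hk⟩))

variable {L₀ L₁ L : MLine (KBKFlq n)}

/-- `L` arises from `L₀` and `L₁` by resolution over `x`. -/
def IsRes (x : KBKFVar n) (L₀ L₁ L : MLine (KBKFlq n)) : Prop :=
  (x, true) ∈ L₀.clause ∧ (x, false) ∈ L₁.clause ∧ L.clause = resolvent L₀.clause L₁.clause x ∧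
    ∀ k, Combines (KBKFlq n) x (.x, k) (xmap L₀ k) (xmap L₁ k) (xmap L k)

theorem PosLine.eq_of_mem {j m : Fin n} (h : PosLine L j) (hm : ((.f, m), true) ∈ L.clause) :
    j = m := by
  rcases h.2.1 _ hm with h | ⟨_, _, h⟩
  · simp only [Prod.mk.injEq, true_and, and_true] at h
    exact h.symm
  · simp at h

/-- No map can be merged over `f_m`, so all maps stay constant. The literal lost by resolving, the
negation of `f_m`, is paid for by the nontrivial map of `x_m` in the left premise. -/
theorem PosLine.res {m j : Fin n} (hr : IsRes (.f, m) L₀ L₁ L) (h₀ : PosLine L₀ m)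
    (h₁ : PosLine L₁ j) : PosLine L j := by
  obtain ⟨hm₀, hm₁, hC, hM⟩ := hr
  obtain ⟨p1, p2, p3, p4, p5⟩ := h₀
  obtain ⟨q1, q2, q3, q4, q5⟩ := h₁
  have hjm : j < m := by
    rcases q2 _ hm₁ with h | ⟨k, hk, h⟩
    · simp at h
    · simp only [Prod.mk.injEq, true_and, and_true] at h
      exact h ▸ hk
  refine ⟨?_, ?_, fun k => (hM k).exists_isConst (not_leftOf_x _ _) (p3 k) (q3 k), ?_, ?_⟩
  · rw [hC, mem_resolvent]
    exact .inr ⟨by simp, q1⟩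
  · intro l hl
    rw [hC, mem_resolvent] at hl
    rcases hl with ⟨hne, hl⟩ | ⟨hne, hl⟩
    · rcases p2 l hl with h | ⟨k, hk, h⟩
      · exact absurd h hne
      · exact .inr ⟨k, hjm.trans hk, h⟩
    · exact q2 l hl
  · intro h
    exact q4 ((or_self_iff).mp ((hM j).right h))
  · intro k hk
    by_cases hkm : k = m
    · subst hkm
      exact .inr fun h => p4 ((or_self_iff).mp ((hM k).left h))
    · rcases q5 k hk with h | h
      · left
        rw [hC, mem_resolvent]
        exact .inr ⟨by simp [hkm], h⟩
      · exact .inr fun h' => h ((or_self_iff).mp ((hM k).right h'))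

/-- The left premise contributes only negated `f_k`, so positive literals, literals of `d` and `e`,
and falsification are governed by the right premise. The map of `x_m` becomes nontrivial exactly
when the negation of `f_m` may disappear. -/
theorem NegLine.res_f {α : Fin n → Bool} {m : Fin n} (hr : IsRes (.f, m) L₀ L₁ L)
    (h₀ : PosLine L₀ m) (h₁ : NegLine α L₁) : NegLine α L := by
  obtain ⟨hm₀, hm₁, hC, hM⟩ := hr
  obtain ⟨p1, p2, p3, p4, p5⟩ := h₀
  have htriv : ∀ k, (xmap L k).IsConst none → (xmap L₁ k).IsConst none := fun k h =>
    (or_self_iff).mp ((hM k).right h)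
  have hfals : ∀ k, Fals (asg α k) L.clause → Fals (asg α k) L₁.clause := fun k h =>
    (hC ▸ h).right rfl
  have hpos : ∀ l ∈ L.clause, l.2 = true → l ∈ L₁.clause := by
    intro l hl hl2
    rw [hC, mem_resolvent] at hl
    rcases hl with ⟨hne, hl⟩ | ⟨hne, hl⟩
    · rcases p2 l hl with h | ⟨k, hk, h⟩
      · exact absurd h hne
      · simp [h] at hl2
    · exact hl
  have hpos' : ∀ l ∈ L₁.clause, l.2 = true → l ∈ L.clause := by
    intro l hl hl2
    rw [hC, mem_resolvent]
    refine .inr ⟨?_, hl⟩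
    rintro rfl
    simp at hl2
  have hneg : ∀ l ∈ L.clause, l.1.1 ≠ .f → l ∈ L₁.clause := by
    intro l hl hl2
    rw [hC, mem_resolvent] at hl
    rcases hl with ⟨hne, hl⟩ | ⟨hne, hl⟩
    · rcases p2 l hl with h | ⟨k, hk, h⟩
      · exact absurd h hne
      · simp [h] at hl2
    · exact hl
  refine ⟨fun j hj => h₁.notMem_f j (hpos _ hj rfl), ?_, ?_, ?_, ?_, ?_, ?_, ?_⟩
  · exact fun l hl l' hl' h h' => h₁.pos_unique l (hpos l hl h) l' (hpos l' hl' h') h h'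
  · exact fun l hl l' hl' h h' hf => h₁.pos_lt_neg l (hpos l hl h) l' (hneg l' hl' hf) h h' hf
  · exact fun l hl h k hk => (hM k).exists_isConst (not_leftOf_x _ _) (p3 k)
      (h₁.isConst_below l (hpos l hl h) h k hk)
  · intro k hk
    have hkm : k ≠ m := by
      rintro rfl
      exact p4 ((or_self_iff).mp ((hM k).left hk))
    rw [hC, mem_resolvent]
    exact .inr ⟨by simp [hkm], h₁.mem_of_trivial k (htriv k hk)⟩
  · exact fun l hl h hf k hk hle h' => h₁.nontrivial_of_neg l (hneg l hl hf) h hf k hk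
      (fun l' hl' hp => hle l' (hpos' l' hl' hp) hp) (htriv k h')
  · exact fun h k hle h' => h₁.nontrivial_of_fals (hfals n h) k
      (fun l' hl' hp => hle l' (hpos' l' hl' hp) hp) (htriv k h')
  · intro k h b hb
    rcases (hM k).right hb with h' | h'
    · exact absurd (h₁.eq_of_fals k (hfals _ h) _ h') (by simp)
    · exact h₁.eq_of_fals k (hfals _ h) _ h'

/-- The pivot is the only positive literal of the left premise, so a positive literal of the
conclusion comes from the right one and has index below `j`. Nontriviality of the map of `x_k` is
then inherited from the right premise for `k < j`. For `k ≥ j` it comes from the premise that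
contains the negative literal in question or is falsified. -/
theorem NegLine.res_de {α : Fin n → Bool} {K : KBKFKind} {j : Fin n} (hK : K = .d ∨ K = .e)
    (hr : IsRes (K, j) L₀ L₁ L) (h₀ : NegLine α L₀) (h₁ : NegLine α L₁) : NegLine α L := by
  obtain ⟨hz₀, hz₁, hC, hM⟩ := hr
  have hKf : K ≠ .f := by rcases hK with rfl | rfl <;> simp
  have htriv₀ : ∀ k, (xmap L k).IsConst none → (xmap L₀ k).IsConst none := fun k h =>
    (or_self_iff).mp ((hM k).left h)
  have htriv₁ : ∀ k, (xmap L k).IsConst none → (xmap L₁ k).IsConst none := fun k h =>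
    (or_self_iff).mp ((hM k).right h)
  have hpos₀ : ∀ l ∈ L₀.clause, l.2 = true → l = ((K, j), true) := fun l hl h =>
    h₀.pos_unique l hl _ hz₀ h rfl
  have hpos : ∀ l ∈ L.clause, l.2 = true → l ∈ L₁.clause := by
    intro l hl hl2
    rw [hC, mem_resolvent] at hl
    rcases hl with ⟨hne, hl⟩ | ⟨hne, hl⟩
    · exact absurd (hpos₀ l hl hl2) hne
    · exact hl
  have hpos' : ∀ l ∈ L₁.clause, l.2 = true → l ∈ L.clause := by
    intro l hl hl2
    rw [hC, mem_resolvent]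
    refine .inr ⟨?_, hl⟩
    rintro rfl
    simp at hl2
  have hlt : ∀ l ∈ L.clause, l.2 = true → l.1.2 < j := fun l hl h =>
    h₁.pos_lt_neg l (hpos l hl h) _ hz₁ h rfl hKf
  have hbelow : ∀ k, k < j → (∀ l' ∈ L.clause, l'.2 = true → l'.1.2 ≤ k) →
      ¬ (xmap L k).IsConst none := fun k hk hle h =>
    h₁.nontrivial_of_neg _ hz₁ rfl hKf k hk (fun l' hl' hp => hle l' (hpos' l' hl' hp) hp)
      (htriv₁ k h)
  have hle₀ : ∀ k, j ≤ k → ∀ l' ∈ L₀.clause, l'.2 = true → l'.1.2 ≤ k := fun k hk l' hl' hp => by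
    rw [hpos₀ l' hl' hp]
    exact hk
  refine ⟨fun i hi => h₁.notMem_f i (hpos _ hi rfl), ?_, ?_, ?_, ?_, ?_, ?_, ?_⟩
  · exact fun l hl l' hl' h h' => h₁.pos_unique l (hpos l hl h) l' (hpos l' hl' h') h h'
  · intro l hl l' hl' h h' hf
    have hl'' := hl'
    rw [hC, mem_resolvent] at hl''
    rcases hl'' with ⟨-, hl''⟩ | ⟨-, hl''⟩
    · exact (hlt l hl h).trans (h₀.pos_lt_neg _ hz₀ l' hl'' rfl h' hf)
    · exact h₁.pos_lt_neg l (hpos l hl h) l' hl'' h h' hf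
  · intro l hl h k hk
    have hkj : k < j := hk.trans (hlt l hl h)
    exact (hM k).exists_isConst (by rw [leftOf_x hK]; exact not_le.mpr hkj)
      (h₀.isConst_below _ hz₀ rfl k hkj) (h₁.isConst_below l (hpos l hl h) h k hk)
  · intro k hk
    rw [hC, mem_resolvent]
    exact .inr ⟨by simp [hKf.symm], h₁.mem_of_trivial k (htriv₁ k hk)⟩
  · intro l hl h hf k hk hle
    rcases lt_or_ge k j with hkj | hkj
    · exact hbelow k hkj hle
    rw [hC, mem_resolvent] at hl
    rcases hl with ⟨-, hl⟩ | ⟨-, hl⟩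
    · exact fun h' => h₀.nontrivial_of_neg l hl h hf k hk (hle₀ k hkj) (htriv₀ k h')
    · exact fun h' => h₁.nontrivial_of_neg l hl h hf k hk
        (fun l' hl' hp => hle l' (hpos' l' hl' hp) hp) (htriv₁ k h')
  · intro h k hle
    rcases lt_or_ge k j with hkj | hkj
    · exact hbelow k hkj hle
    rw [hC] at h
    cases hσ : asg α n (K, j) with
    | false => exact fun h' => h₀.nontrivial_of_fals (h.left hσ) k (hle₀ k hkj) (htriv₀ k h')
    | true =>
      exact fun h' => h₁.nontrivial_of_fals (h.right hσ) k
        (fun l' hl' hp => hle l' (hpos' l' hl' hp) hp) (htriv₁ k h')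
  · intro k h b hb
    rw [hC] at h
    cases hσ : asg α (k + 1) (K, j) with
    | false =>
      rcases (hM k).left hb with h' | h'
      · exact absurd (h₀.eq_of_fals k (h.left hσ) _ h') (by simp)
      · exact h₀.eq_of_fals k (h.left hσ) _ h'
    | true =>
      rcases (hM k).right hb with h' | h'
      · exact absurd (h₁.eq_of_fals k (h.right hσ) _ h') (by simp)
      · exact h₁.eq_of_fals k (h.right hσ) _ h'

theorem mResStep_cases {π : List (MLine (KBKFlq n))} (h : MResStep (KBKFlq n) π L) :
    (∃ a, L.clause = (KBKFlq n).exPart (clauseA n) ∧ ∀ k, xmap L k = MergeMap.simple a none) ∨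
    (∃ v i a, L.clause = (KBKFlq n).exPart (clauseDE v i) ∧
      ∀ k, xmap L k = MergeMap.simple a (if k = i then some v else none)) ∨
    (∃ b i a, L.clause = (KBKFlq n).exPart (clauseB b i) ∧
      ∀ k, xmap L k = MergeMap.simple a (if k = i then some (!b) else none)) ∨
    ∃ L₀ ∈ π, ∃ L₁ ∈ π, ∃ x, (KBKFlq n).IsEx x ∧ IsRes x L₀ L₁ L := by
  cases h with
  | download A a hA _ =>
    rcases mem_matrix.mp hA with rfl | ⟨v, i, rfl⟩ | ⟨b, i, rfl⟩
    · exact .inl ⟨a, rfl, fun k => by simp [xmap, falsifyingValue_clauseA]⟩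
    · exact .inr (.inl ⟨v, i, a, rfl, fun k => by simp [xmap, falsifyingValue_clauseDE]⟩)
    · exact .inr (.inr (.inl ⟨b, i, a, rfl, fun k => by simp [xmap, falsifyingValue_clauseB]⟩))
  | res L₀ L₁ x M h₀ h₁ hx hx₀ hx₁ hM =>
    exact .inr (.inr (.inr ⟨L₀, h₀, L₁, h₁, x, hx, hx₀, hx₁, rfl, fun k => hM _⟩))

/-- A resolution step is over some `f_m`, with a positive left premise, or over some `d_j`
or `e_j`. -/
theorem IsRes.cases {α : Fin n → Bool} {x : KBKFVar n} (hx : (KBKFlq n).IsEx x)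
    (hr : IsRes x L₀ L₁ L) (h₀ : NegLine α L₀ ∨ ∃ j, PosLine L₀ j)
    (h₁ : NegLine α L₁ ∨ ∃ j, PosLine L₁ j) :
    (∃ m, x = (.f, m) ∧ PosLine L₀ m) ∨
      ∃ K j, (K = .d ∨ K = .e) ∧ x = (K, j) ∧ NegLine α L₀ ∧ NegLine α L₁ := by
  obtain ⟨K, j⟩ := x
  obtain ⟨hx₀, hx₁, -⟩ := hr
  have hneg : (K = .d ∨ K = .e) → NegLine α L₀ ∧ NegLine α L₁ := by
    intro hK
    have hKf : K ≠ .f := by rcases hK with rfl | rfl <;> simp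
    constructor
    · rcases h₀ with h | ⟨i, h⟩
      · exact h
      · rcases h.2.1 _ hx₀ with h | ⟨_, _, h⟩ <;> simp [hKf] at h
    · rcases h₁ with h | ⟨i, h⟩
      · exact h
      · rcases h.2.1 _ hx₁ with h | ⟨_, _, h⟩ <;> simp [hKf] at h
  cases K with
  | d => exact .inr ⟨_, _, .inl rfl, rfl, hneg (.inl rfl)⟩
  | e => exact .inr ⟨_, _, .inr rfl, rfl, hneg (.inr rfl)⟩
  | x => exact absurd rfl (isEx_iff.mp hx)
  | f =>
    rcases h₀ with h | ⟨i, h⟩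
    · exact absurd hx₀ (h.notMem_f j)
    · obtain rfl := h.eq_of_mem hx₀
      exact .inl ⟨_, rfl, h⟩

theorem negLine_or_posLine (α : Fin n → Bool) {π : List (MLine (KBKFlq n))}
    (hπ : Derivation (MResStep (KBKFlq n)) π) :
    ∀ L ∈ π, NegLine α L ∨ ∃ j, PosLine L j := by
  induction hπ with
  | nil => simp
  | @cons π L hπ hs ih =>
    refine List.forall_mem_cons.mpr ⟨?_, ih⟩
    rcases mResStep_cases hs with ⟨a, hC, hm⟩ | ⟨v, i, a, hC, hm⟩ | ⟨b, i, a, hC, hm⟩ |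
      ⟨L₀, h₀, L₁, h₁, x, hx, hr⟩
    · exact .inl (negLine_clauseA α hC)
    · exact .inl (negLine_clauseDE α hC hm)
    · exact .inr ⟨i, posLine_clauseB hC hm⟩
    · rcases hr.cases hx (ih L₀ h₀) (ih L₁ h₁) with ⟨m, rfl, hp⟩ | ⟨K, j, hK, rfl, hn₀, hn₁⟩
      · rcases ih L₁ h₁ with hn | ⟨j, hj⟩
        · exact .inl (hn.res_f hr hp)
        · exact .inr ⟨j, hp.res hr hj⟩
      · exact .inl (hn₀.res_de hK hr hn₁)

/-- As long as `¬f_i` is present, the merge maps of `x_i, ..., x_n` are constant.  Lines that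
violate this condition cannot be used in a refutation. -/
def Undoomed (L : MLine (KBKFlq n)) : Prop :=
  ∀ i k : Fin n, i ≤ k → ((.f, i), false) ∈ L.clause → ∃ b, (xmap L k).IsConst b

/-- The condition travels from the conclusion back to the premise. If the left premise has a
nontrivial constant map for `x_k`, the result is constant without merging. If it is trivial, then `k
> m` and the negation of `f_k` enters the conclusion, where the hypothesis applies. -/
theorem Undoomed.of_res_f {m : Fin n} (hr : IsRes (.f, m) L₀ L₁ L) (h₀ : PosLine L₀ m)
    (h : Undoomed L) : Undoomed L₁ := by
  obtain ⟨hm₀, hm₁, hC, hM⟩ := hr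
  obtain ⟨p1, p2, p3, p4, p5⟩ := h₀
  have hconst : ∀ k, (∃ b, (xmap L k).IsConst b) → ∃ b, (xmap L₁ k).IsConst b := by
    rintro k ⟨b, hb⟩
    rcases (hM k).right hb with h | h <;> exact ⟨_, h⟩
  intro i k hik hi
  apply hconst
  by_cases him : i = m
  · subst him
    obtain ⟨b, hb⟩ := p3 k
    rcases (hM k).trivial_or (not_leftOf_x _ _) hb with h' | h'
    · rcases hik.eq_or_lt with rfl | hlt
      · exact absurd h' p4
      · rcases p5 k hlt with hk | hk
        · refine h k k le_rfl ?_
          rw [hC, mem_resolvent]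
          exact .inl ⟨by simp, hk⟩
        · exact absurd h' hk
    · exact ⟨b, h'⟩
  · refine h i k hik ?_
    rw [hC, mem_resolvent]
    exact .inr ⟨by simp [him], hi⟩

/-- The line agrees with `α` on each `x_k`, or is falsified by the `k`th truncation of `α`. -/
def Good (α : Fin n → Bool) (L : MLine (KBKFlq n)) : Prop :=
  ∀ k : Fin n, Fals (asg α (k + 1)) L.clause ∨ (xmap L k).IsConst none ∨
    (xmap L k).IsConst (some (α k))

/-- A descent towards the axioms along falsified premises, starting from a line with a nonconstant
map. Axioms have constant maps, so some step over a `d_j` or `e_j` leads to a line with all maps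
constant. `Good` and the exclusion of trivial maps make their values equal to `α`. -/
theorem exists_constant_line (α : Fin n → Bool) {π : List (MLine (KBKFlq n))}
    (hπ : Derivation (MResStep (KBKFlq n)) π) :
    ∀ L ∈ π, NegLine α L → Undoomed L → Fals (asg α n) L.clause → Good α L →
      (∃ k, ∀ b, ¬ (xmap L k).IsConst b) → ∃ Q ∈ π, ∀ k, (xmap Q k).IsConst (some (α k)) := by
  induction hπ with
  | nil => simp
  | @cons π L hπ hs ih =>
    have hinv := negLine_or_posLine α hπ
    have hsub : (∃ Q ∈ π, ∀ k, (xmap Q k).IsConst (some (α k))) →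
        ∃ Q ∈ L :: π, ∀ k, (xmap Q k).IsConst (some (α k)) :=
      fun ⟨Q, hQ, h⟩ => ⟨Q, List.mem_cons_of_mem _ hQ, h⟩
    refine List.forall_mem_cons.mpr ⟨?_, fun L' hL' h1 h2 h3 h4 h5 =>
      hsub (ih L' hL' h1 h2 h3 h4 h5)⟩
    rintro hneg hund hfals hgood ⟨p, hp⟩
    apply hsub
    rcases mResStep_cases hs with ⟨a, hC, hm⟩ | ⟨v, i, a, hC, hm⟩ | ⟨b, i, a, hC, hm⟩ |
      ⟨L₀, h₀, L₁, h₁, x, hx, hr⟩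
    · exact absurd ⟨a, hm p⟩ (hp _)
    · exact absurd ⟨a, hm p⟩ (hp _)
    · exact absurd ⟨a, hm p⟩ (hp _)
    rcases hr.cases hx (hinv L₀ h₀) (hinv L₁ h₁) with ⟨m, rfl, hpos⟩ | ⟨K, j, hK, rfl, hn₀, hn₁⟩
    · have hn₁ : NegLine α L₁ := by
        rcases hinv L₁ h₁ with h | ⟨j, hj⟩
        · exact h
        · exact absurd (hpos.res hr hj).1 (hneg.notMem_f j)
      have hund₁ := hund.of_res_f hr hpos
      obtain ⟨-, -, hC, hM⟩ := hr
      have hf : ∀ k, Fals (asg α k) L.clause → Fals (asg α k) L₁.clause := fun k h =>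
        (hC ▸ h).right rfl
      refine ih L₁ h₁ hn₁ hund₁ (hf n hfals) (fun k => ?_) ⟨p, fun b hb => ?_⟩
      · rcases hgood k with h | h | h
        · exact .inl (hf _ h)
        · exact .inr (.inl ((or_self_iff).mp ((hM k).right h)))
        · exact .inr ((hM k).right h)
      · obtain ⟨c, hc⟩ := (hM p).exists_isConst (not_leftOf_x _ _) (hpos.2.2.1 p) ⟨b, hb⟩
        exact hp c hc
    · obtain ⟨hz₀, hz₁, hC, hM⟩ := hr
      have hKf : K ≠ .f := by rcases hK with rfl | rfl <;> simp
      -- The pivot is not left of `x_k`, so the constant map of the left premise is either kept or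
      -- trivial. In the latter case the negation of `f_k` survives in `L`, and `Undoomed` applies.
      have hbelow : ∀ k, k < j → ∃ b, (xmap L k).IsConst b := by
        intro k hkj
        obtain ⟨b, hb⟩ := hn₀.isConst_below _ hz₀ rfl k hkj
        rcases (hM k).trivial_or (by rw [leftOf_x hK]; exact not_le.mpr hkj) hb with h | h
        · refine hund k k le_rfl ?_
          rw [hC, mem_resolvent]
          exact .inl ⟨by simp, hn₀.mem_of_trivial k h⟩
        · exact ⟨b, h⟩
      have hjp : j ≤ p := by
        by_contra! h
        obtain ⟨b, hb⟩ := hbelow p h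
        exact hp b hb
      have hasg : ∀ k : Fin n, j ≤ k → asg α (k + 1) (K, j) = asg α n (K, j) := by
        intro k hk
        have hk' : (j : ℕ) < k + 1 := Nat.lt_succ_iff.mpr hk
        rcases hK with rfl | rfl <;> simp [asg, hk']
      -- `La` stands for the premise on the side selected by the value of the pivot under `α`; the
      -- hypotheses are what both sides have in common.
      have key : ∀ La ∈ π, NegLine α La →
          (∀ i, ((.f, i), false) ∈ La.clause → ((.f, i), false) ∈ L.clause) →
          (∀ k b, (xmap L k).IsConst b → (xmap La k).IsConst none ∨ (xmap La k).IsConst b) →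
          (∀ k, asg α k (K, j) = asg α n (K, j) → Fals (asg α k) L.clause →
            Fals (asg α k) La.clause) →
          (∀ l ∈ La.clause, l.2 = true → l.1.2 ≤ j) →
          ∃ Q ∈ π, ∀ k, (xmap Q k).IsConst (some (α k)) := by
        intro La hLa hna hfa hca hσa hpa
        have hunda : Undoomed La := by
          intro i k hik hi
          obtain ⟨b, hb⟩ := hund i k hik (hfa i hi)
          rcases hca k b hb with h | h <;> exact ⟨_, h⟩
        have hgooda : Good α La := by
          intro k
          rcases hgood k with h | h | h
          -- For `k < j` the truncation sets the pivot to 1 regardless of `α`, so falsification need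
          -- not pass to `La`. But then the map in `L` is constant, and falsification of `L` already
          -- fixes its value as `α k`.
          · rcases lt_or_ge k j with hkj | hkj
            · obtain ⟨b, hb⟩ := hbelow k hkj
              obtain rfl := hneg.eq_of_fals k h b hb
              exact .inr (hca k _ hb)
            · exact .inl (hσa _ (hasg k hkj) h)
          · exact .inr (.inl ((or_self_iff).mp (hca k _ h)))
          · exact .inr (hca k _ h)
        have hfalsa := hσa n rfl hfals
        by_cases hall : ∃ k, ∀ b, ¬ (xmap La k).IsConst b
        · exact ih La hLa hna hunda hfalsa hgooda hall
        push Not at hall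
        refine ⟨La, hLa, fun k => ?_⟩
        -- For `k ≤ p` a trivial map would keep the negation of `f_k` in `L`, and `Undoomed` would
        -- make the map of `x_p` constant. For `k > p` the index lies above every positive literal,
        -- and falsification excludes triviality.
        have hnt : ¬ (xmap La k).IsConst none := by
          rcases le_or_gt k p with hkp | hkp
          · intro h
            obtain ⟨b, hb⟩ := hund k p hkp (hfa k (hna.mem_of_trivial k h))
            exact hp b hb
          · exact hna.nontrivial_of_fals hfalsa k fun l hl h =>
              (hpa l hl h).trans (hjp.trans hkp.le)
        rcases hgooda k with h | h | h
        · obtain ⟨b, hb⟩ := hall k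
          exact hna.eq_of_fals k h b hb ▸ hb
        · exact absurd h hnt
        · exact h
      cases hσ : asg α n (K, j) with
      | false =>
        refine key L₀ h₀ hn₀ (fun i hi => ?_) (fun k b hb => (hM k).left hb) (fun k hk h => ?_)
          (fun l hl h => ?_)
        · rw [hC, mem_resolvent]
          exact .inl ⟨by simp, hi⟩
        · exact (hC ▸ h).left (hk.trans hσ)
        · rw [hn₀.pos_unique l hl _ hz₀ h rfl]
      | true =>
        refine key L₁ h₁ hn₁ (fun i hi => ?_) (fun k b hb => (hM k).right hb) (fun k hk h => ?_)
          (fun l hl h => (hn₁.pos_lt_neg l hl _ hz₁ h rfl hKf).le)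
        · rw [hC, mem_resolvent]
          exact .inr ⟨by simp [hKf.symm], hi⟩
        · exact (hC ▸ h).right (hk.trans hσ)

end KBKF

open KBKF in
theorem hard_MRes_KBKFlq : Hard MRes KBKFlq := by
  refine hard_of_two_pow_le ?_
  rintro n _ ⟨π, L, hπ, hL, rfl⟩
  refine two_pow_le_length (L :: π) (fun Q α => ∀ k, (xmap Q k).IsConst (some (α k))) ?_ ?_
  · intro Q α β hα hβ
    funext k
    exact Option.some.inj ((hα k).unique (hβ k))
  · intro α
    have hneg : NegLine α L := by
      rcases negLine_or_posLine α hπ L List.mem_cons_self with h | ⟨j, h⟩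
      · exact h
      · simp [PosLine, hL] at h
    have hfals : ∀ k, Fals (asg α k) L.clause := fun k l hl => by simp [hL] at hl
    by_cases hall : ∃ k, ∀ b, ¬ (xmap L k).IsConst b
    · exact exists_constant_line α hπ L List.mem_cons_self hneg
        (fun i k _ hi => by simp [hL] at hi) (hfals n) (fun k => .inl (hfals _)) hall
    · push Not at hall
      refine ⟨L, List.mem_cons_self, fun k => ?_⟩
      obtain ⟨b, hb⟩ := hall k
      exact hneg.eq_of_fals k (hfals _) b hb ▸ hb

end QProof

theorem corollary5p9 :
    QProof.Incomparable QProof.MRes QProof.QURes ∧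
    QProof.Incomparable QProof.MRes QProof.CPRed ∧
    QProof.Incomparable QProof.MRes QProof.CPRedBits ∧
    QProof.Hard QProof.MRes QProof.KBKFlq ∧
    QProof.Easy QProof.QURes QProof.KBKFlq ∧
    QProof.Easy QProof.CPRed QProof.KBKFlq ∧
    QProof.Easy QProof.CPRedBits QProof.KBKFlq ∧
    QProof.Simulates QProof.CPRed QProof.QURes ∧
    QProof.Simulates QProof.CPRedBits QProof.QURes ∧
    QProof.Easy QProof.MRes QProof.Equality ∧
    QProof.Hard QProof.QURes QProof.Equality ∧
    QProof.Hard QProof.CPRed QProof.Equality ∧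
    QProof.Hard QProof.CPRedBits QProof.Equality := by
  have hM := QProof.hard_MRes_KBKFlq
  have hQ := QProof.easy_QURes_KBKFlq
  have hC := hQ.of_simulates QProof.simulates_CPRed_QURes
  have hB := hQ.of_simulates QProof.simulates_CPRedBits_QURes
  have eM := QProof.easy_MRes_Equality
  have eC := QProof.hard_CPRed_Equality
  have eB := QProof.hard_CPRedBits_Equality
  have eQ := eC.of_simulates QProof.simulates_CPRed_QURes
  exact ⟨⟨QProof.not_simulates hM hQ, QProof.not_simulates eQ eM⟩,
    ⟨QProof.not_simulates hM hC, QProof.not_simulates eC eM⟩,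
    ⟨QProof.not_simulates hM hB, QProof.not_simulates eB eM⟩,
    hM, hQ, hC, hB, QProof.simulates_CPRed_QURes, QProof.simulates_CPRedBits_QURes, eM, eQ, eC, eB⟩
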